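/- Let $\alpha\in\mathbb{C}$ with $\mathrm{Im}(\alpha)>0$, let $I\subset\mathbb{R}$ be a non-empty bounded interval (of any type; a single point is allowed) with characteristic function $\chi_I$, and let $\delta>0$. Define $$\rho(\alpha,I,\delta)=\inf_G\int_{-\infty}^{\infty}\{G(t)-\chi_I(t)\}\,dt,$$ where the infimum is taken over all entire functions $G$ that are real valued and integrable on $\mathbb{R}$ and satisfy (i) $G(t)\ge\chi_I(t)$ for all $t\in\mathbb{R}$; (ii) $\hat G(\xi)=\int_{-\infty}^{\infty}e^{-2\pi i t\xi}G(t)\,dt=0$ whenever $|\xi|>\delta$; (iii) $G(\alpha)=0$. Then $$\delta^{-2}\ll\rho(\alpha,I,\delta)\ll\delta^{-3}\quad\text{as }\delta\to0^+,\qquad\text{and}\qquad \delta^{-1}\ll\rho(\alpha,I,\delta)\ll\delta^{-1}\quad\text{as }\delta\to\infty.$$ The implied constants (and the ranges of $\delta$) depend only on $\alpha$ and $I$ and are effective, in the following sense: there is a computable function $A:\mathbb{N}\to\mathbb{N}$ with positive values such that, whenever $N$ is a positive integer with $|\alpha|\le N$, $\mathrm{Im}(\alpha)\ge 1/N$ and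 $I\subseteq[-N,N]$, we have $A(N)^{-1}\delta^{-2}\le\rho(\alpha,I,\delta)\le A(N)\,\delta^{-3}$ for all $0<\delta\le A(N)^{-1}$, and $A(N)^{-1}\delta^{-1}\le\rho(\alpha,I,\delta)\le A(N)\,\delta^{-1}$ for all $\delta\ge A(N)$. -/

import Mathlib

open scoped FourierTransform

/-- `G` is admissible for the point `α`, the interval `I` and the bandwidth `δ`: it is an entire
function, real valued and integrable on the real line, whose restriction to `ℝ` majorizes the
characteristic function of `I`, whose Fourier transform `ξ ↦ ∫ e^{-2πitξ} G(t) dt` vanishes for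
`|ξ| > δ`, and which vanishes at `α`. -/
structure IsAdmissibleMajorant (α : ℂ) (I : Set ℝ) (δ : ℝ) (G : ℂ → ℂ) : Prop where
  entire : Differentiable ℂ G
  integrable : MeasureTheory.Integrable (fun t : ℝ => G (t : ℂ))
  real_valued : ∀ t : ℝ, (G (t : ℂ)).im = 0
  majorant : ∀ t : ℝ, I.indicator (fun _ => (1 : ℝ)) t ≤ (G (t : ℂ)).re
  fourier_eq_zero : ∀ ξ : ℝ, δ < |ξ| → 𝓕 (fun t : ℝ => G (t : ℂ)) ξ = 0
  vanishing : G α = 0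

/-- The least excess `ρ(α, I, δ) = inf ∫ (G(t) - χ_I(t)) dt` over all admissible majorants `G`.
The set is bounded below by `0`. -/
noncomputable def rho (α : ℂ) (I : Set ℝ) (δ : ℝ) : ℝ :=
  sInf {r : ℝ | ∃ G : ℂ → ℂ, IsAdmissibleMajorant α I δ G ∧
    r = ∫ t : ℝ, ((G (t : ℂ)).re - I.indicator (fun _ => (1 : ℝ)) t)}

/-! The excess E of an admissible G is the L¹ norm of G − χ_I, so ‖G‖₁ = E + |I|. Moreover Ĝ is
bounded by ‖G‖₁ and supported in [-δ, δ].

Lower bounds. For small δ, Fourier inversion makes G nearly constant on a fixed disc: increments are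
O(‖G‖₁ δ²), one δ coming from the length of the band and one from the variation of the exponentials
(`norm_sub_le_of_bandlimited`). Since G ≥ 1 on I and G(α) = 0, this forces ‖G‖₁ ≫ δ⁻². For large δ
the zero at α plays no role: off the band the transform of χ_I is bounded by E, and some ξ ≍ δ gives
it modulus 1/(πξ); if |I|δ is small, the bound sup |G| ≤ 2δ‖G‖₁ on the line suffices.

Upper bounds. Entire functions of type 4δ ≤ 2πδ with quadratic decay have band δ, by a contour
shift. For small δ, a multiple of |t − α|² sinc(δt)⁴ works, with integral of order δ⁻²·δ⁻¹. For
large δ, take a majorant M of I of type 2δ and excess O(δ⁻¹) (`exists_bandlimited_majorant`), and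
add (p + rz)² sinc(δz)⁴ with value −M(α) at α (`exists_nonneg_bandlimited_eq`). There M is O(δ
exp(2δ Im α)) while |sinc(δα)|⁴ ≫ δ⁻⁴ exp(4δ Im α), so the correction is exponentially cheap.

Every constant is an absolute one times a power of N, which yields A(N) = B(N+1)¹⁴. -/

open MeasureTheory

/-! ### Fourier inversion and size bounds for band-limited functions. -/

/-- An interval integral of functions holomorphic in a parameter is entire. -/
lemma differentiable_intervalIntegral {F F' : ℂ → ℝ → ℂ} (hF : Continuous (Function.uncurry F))
    (hF' : Continuous (Function.uncurry F')) (h : ∀ z u, HasDerivAt (fun w => F w u) (F' z u) z)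
    (a b : ℝ) : Differentiable ℂ fun z => ∫ u in a..b, F z u := by
  intro z
  have hc (w : ℂ) : Continuous (F w) := by fun_prop
  have hc' (w : ℂ) : Continuous (F' w) := by fun_prop
  obtain ⟨C, hC⟩ := ((isCompact_closedBall z 1).prod (isCompact_uIcc (a := a) (b := b))
    ).exists_bound_of_continuousOn hF'.continuousOn
  refine (intervalIntegral.hasDerivAt_integral_of_dominated_loc_of_deriv_le (F' := F')
    (Metric.ball_mem_nhds z one_pos) (bound := fun _ => C)
    (.of_forall fun w => (hc w).aestronglyMeasurable) ((hc z).intervalIntegrable _ _)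
    (hc' z).aestronglyMeasurable (.of_forall fun u hu w hw => ?_) (by simp)
    (.of_forall fun u _ w _ => h w u)).2.differentiableAt
  exact hC (w, u) ⟨Metric.ball_subset_closedBall hw, Set.uIoc_subset_uIcc hu⟩

lemma continuous_fourier_of_integrable {f : ℝ → ℂ} (hf : Integrable f) : Continuous (𝓕 f) :=
  VectorFourier.fourierIntegral_continuous Real.continuous_fourierChar continuous_inner hf

lemma norm_fourier_le (f : ℝ → ℂ) (ξ : ℝ) : ‖𝓕 f ξ‖ ≤ ∫ t, ‖f t‖ :=
  VectorFourier.norm_fourierIntegral_le_integral_norm _ _ _ _ _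

/-- Entire functions that agree on the real line are equal. -/
lemma Differentiable.eq_of_eqOn_real {f g : ℂ → ℂ} (hf : Differentiable ℂ f)
    (hg : Differentiable ℂ g) (h : ∀ t : ℝ, f t = g t) : f = g := by
  refine AnalyticOnNhd.eq_of_frequently_eq (z₀ := 0)
    (fun z _ => hf.analyticAt z) (fun z _ => hg.analyticAt z) ?_
  have hT : Filter.Tendsto (fun n : ℕ => (((1 / ((n : ℝ) + 1) : ℝ)) : ℂ)) Filter.atTop
      (nhdsWithin 0 {0}ᶜ) := by
    refine tendsto_nhdsWithin_iff.2 ⟨?_, .of_forall fun n => ?_⟩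
    · have := (Complex.continuous_ofReal.tendsto 0).comp tendsto_one_div_add_atTop_nhds_zero_nat
      simpa [Function.comp_def] using this
    · have : (n : ℝ) + 1 ≠ 0 := by positivity
      simp only [Set.mem_compl_iff, Set.mem_singleton_iff, Complex.ofReal_eq_zero]
      positivity
  exact hT.frequently (.of_forall fun n => h _)

/-- An entire function, integrable on the line and band-limited to `[-δ, δ]`, is the Fourier
integral of its transform at every complex point. -/
lemma eq_integral_fourier {G : ℂ → ℂ} {δ : ℝ} (hδ : 0 < δ) (hG : Differentiable ℂ G)
    (hi : Integrable (fun t : ℝ => G t)) (hF : ∀ ξ : ℝ, δ < |ξ| → 𝓕 (fun t : ℝ => G t) ξ = 0)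
    (z : ℂ) : G z = ∫ ξ in (-δ)..δ, 𝓕 (fun t : ℝ => G t) ξ *
      Complex.exp (2 * Real.pi * ξ * Complex.I * z) := by
  set g : ℝ → ℂ := fun t => G t
  have hcont : Continuous (𝓕 g) := continuous_fourier_of_integrable hi
  have hg : Continuous g := hG.continuous.comp Complex.continuous_ofReal
  have hsupp : ∀ ξ, ξ ∉ Set.Icc (-δ) δ → 𝓕 g ξ = 0 := fun ξ hξ => hF ξ (by
    rw [← not_le, abs_le]; exact hξ)
  have hint : Integrable (𝓕 g) :=
    hcont.integrable_of_hasCompactSupport (HasCompactSupport.intro isCompact_Icc hsupp)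
  have hD : Differentiable ℂ fun z : ℂ => ∫ ξ in (-δ)..δ, 𝓕 g ξ *
      Complex.exp (2 * Real.pi * ξ * Complex.I * z) := by
    refine differentiable_intervalIntegral
      (F := fun z ξ => 𝓕 g ξ * Complex.exp (2 * Real.pi * ξ * Complex.I * z))
      (F' := fun z ξ => 𝓕 g ξ * (Complex.exp (2 * Real.pi * ξ * Complex.I * z) *
        (2 * Real.pi * ξ * Complex.I))) ?_ ?_ (fun z ξ => ?_) _ _
    · simp only [Function.uncurry_def]; fun_prop
    · simp only [Function.uncurry_def]; fun_prop
    · have := ((hasDerivAt_id z).const_mul (2 * Real.pi * ξ * Complex.I : ℂ)).cexp.const_mul (𝓕 g ξ)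
      simpa using this
  -- Both sides are entire, so it is enough to compare them on the real line, where this is Fourier
  -- inversion.
  refine congrFun (hG.eq_of_eqOn_real hD fun t => ?_) z
  have h1 := congrFun (hg.fourierInv_fourier_eq hi hint) t
  rw [Real.fourierInv_eq'] at h1
  change g t = _
  rw [← h1, intervalIntegral.integral_of_le (by linarith), ← integral_Icc_eq_integral_Ioc,
    setIntegral_eq_integral_of_forall_compl_eq_zero (fun ξ hξ => by rw [hsupp ξ hξ, zero_mul])]
  congr 1 with ξ
  simp only [smul_eq_mul]
  rw [mul_comm]
  congr 2
  simp
  ring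

lemma Complex.norm_exp_sub_exp_le {w z : ℂ} {r : ℝ} (hw : ‖w‖ ≤ r) (hz : ‖z‖ ≤ r) :
    ‖exp w - exp z‖ ≤ Real.exp r * ‖w - z‖ := by
  refine (convex_closedBall (0 : ℂ) r).norm_image_sub_le_of_norm_deriv_le (𝕜 := ℂ)
    (fun x _ => Complex.differentiableAt_exp) (fun x hx => ?_) (by simpa using hz) (by simpa using hw)
  rw [Complex.deriv_exp, Complex.norm_exp]
  exact Real.exp_le_exp.2 ((Complex.re_le_norm x).trans (by simpa using hx))

/-- Increments of a band-limited function in terms of its `L¹` norm. -/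
lemma norm_sub_le_of_bandlimited {G : ℂ → ℂ} {δ R : ℝ} (hδ : 0 < δ) (hG : Differentiable ℂ G)
    (hi : Integrable (fun t : ℝ => G t)) (hF : ∀ ξ : ℝ, δ < |ξ| → 𝓕 (fun t : ℝ => G t) ξ = 0)
    {z w : ℂ} (hz : ‖z‖ ≤ R) (hw : ‖w‖ ≤ R) :
    ‖G z - G w‖ ≤ (∫ t : ℝ, ‖G t‖) * (Real.exp (2 * Real.pi * δ * R) *
      (2 * Real.pi * δ * (2 * R))) * (2 * δ) := by
  set g : ℝ → ℂ := fun t => G t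
  have hcont : Continuous (𝓕 g) := continuous_fourier_of_integrable hi
  have hR : 0 ≤ R := (norm_nonneg _).trans hz
  rw [eq_integral_fourier hδ hG hi hF z, eq_integral_fourier hδ hG hi hF w,
    ← intervalIntegral.integral_sub
      (Continuous.intervalIntegrable (by fun_prop) _ _)
      (Continuous.intervalIntegrable (by fun_prop) _ _)]
  refine (intervalIntegral.norm_integral_le_of_norm_le_const (C := (∫ t : ℝ, ‖G t‖) *
    (Real.exp (2 * Real.pi * δ * R) * (2 * Real.pi * δ * (2 * R)))) (fun ξ hξ => ?_)).trans
    (b := _ * |δ - -δ|) (le_of_eq ?_)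
  · rw [← mul_sub, norm_mul]
    have hξ' : |ξ| ≤ δ := by
      rw [Set.uIoc_of_le (by linarith)] at hξ
      exact abs_le.2 ⟨hξ.1.le, hξ.2⟩
    have hn : ‖(2 * Real.pi * ξ * Complex.I : ℂ)‖ ≤ 2 * Real.pi * δ := by
      simp only [norm_mul, Complex.norm_ofNat, Complex.norm_real, Complex.norm_I, mul_one,
        Real.norm_eq_abs, abs_of_pos Real.pi_pos]
      gcongr
    gcongr
    · exact norm_fourier_le _ _
    · refine (Complex.norm_exp_sub_exp_le (r := 2 * Real.pi * δ * R) ?_ ?_).trans ?_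
      · rw [norm_mul]; gcongr
      · rw [norm_mul]; gcongr
      · rw [← mul_sub, norm_mul]
        gcongr
        exact (norm_sub_le _ _).trans (by linarith)
  · rw [abs_of_pos (by linarith)]; ring

/-- A band-limited function is bounded by its `L¹` norm times the bandwidth. -/
lemma norm_le_of_bandlimited {G : ℂ → ℂ} {δ : ℝ} (hδ : 0 < δ) (hG : Differentiable ℂ G)
    (hi : Integrable (fun t : ℝ => G t)) (hF : ∀ ξ : ℝ, δ < |ξ| → 𝓕 (fun t : ℝ => G t) ξ = 0)
    (t : ℝ) : ‖G t‖ ≤ (∫ t : ℝ, ‖G t‖) * (2 * δ) := by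
  rw [eq_integral_fourier hδ hG hi hF t]
  refine (intervalIntegral.norm_integral_le_of_norm_le_const (C := ∫ t : ℝ, ‖G t‖)
    (fun ξ _ => ?_)).trans (b := _ * |δ - -δ|) (le_of_eq ?_)
  · rw [norm_mul, show (2 * Real.pi * ξ * Complex.I * t : ℂ) = ((2 * Real.pi * ξ * t : ℝ) : ℂ) *
      Complex.I by push_cast; ring, Complex.norm_exp_ofReal_mul_I, mul_one]
    exact norm_fourier_le _ _
  · rw [abs_of_pos (by linarith)]; ring

/-! ### Bounded intervals and the transform of their indicator functions. -/

lemma Set.OrdConnected.ae_eq_Icc {I : Set ℝ} (hI : I.OrdConnected) (hne : I.Nonempty)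
    (hb : BddBelow I) (ha : BddAbove I) : I =ᵐ[volume] Set.Icc (sInf I) (sSup I) := by
  have h1 : I ⊆ Set.Icc (sInf I) (sSup I) := fun x hx => ⟨csInf_le hb hx, le_csSup ha hx⟩
  have h2 : Set.Ioo (sInf I) (sSup I) ⊆ I := fun x hx => by
    obtain ⟨y, hy, hyx⟩ := exists_lt_of_csInf_lt hne hx.1
    obtain ⟨z, hz, hxz⟩ := exists_lt_of_lt_csSup hne hx.2
    exact hI.out hy hz ⟨hyx.le, hxz.le⟩
  exact h1.eventuallyLE.antisymm (Ioo_ae_eq_Icc.symm.le.trans h2.eventuallyLE)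

lemma fourier_indicator_Icc {a b ξ : ℝ} (hab : a ≤ b) (hξ : ξ ≠ 0) :
    𝓕 ((Set.Icc a b).indicator fun _ => (1 : ℂ)) ξ =
      (Complex.exp (-2 * Real.pi * ξ * Complex.I * b) -
        Complex.exp (-2 * Real.pi * ξ * Complex.I * a)) / (-2 * Real.pi * ξ * Complex.I) := by
  rw [Real.fourier_real_eq_integral_exp_smul]
  have hc : (-2 * Real.pi * ξ * Complex.I : ℂ) ≠ 0 := by
    simp [hξ, Real.pi_ne_zero]
  rw [← integral_exp_mul_complex hc, intervalIntegral.integral_of_le hab,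
    ← integral_Icc_eq_integral_Ioc, ← integral_indicator measurableSet_Icc]
  congr 1 with t
  by_cases ht : t ∈ Set.Icc a b
  · simp only [Set.indicator_of_mem ht, smul_eq_mul, mul_one]
    congr 1; push_cast; ring
  · simp [Set.indicator_of_notMem ht]

/-- At a half-integral value of ξ(b − a) the two endpoint exponentials are opposite, so the
numerator attains its maximal modulus 2. -/
lemma norm_fourier_indicator_Icc {a b ξ : ℝ} (hab : a ≤ b) (hξ : 0 < ξ) {k : ℕ}
    (hk : ξ * (b - a) = k + 1 / 2) :
    ‖𝓕 ((Set.Icc a b).indicator fun _ => (1 : ℂ)) ξ‖ = (Real.pi * ξ)⁻¹ := by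
  rw [fourier_indicator_Icc hab hξ.ne', norm_div]
  have h1 : Complex.exp (-2 * Real.pi * ξ * Complex.I * b) =
      - Complex.exp (-2 * Real.pi * ξ * Complex.I * a) := by
    have hk' : (ξ * (b - a) : ℂ) = k + 1 / 2 := by 
      rw [← Complex.ofReal_sub, ← Complex.ofReal_mul, hk]; push_cast; ring
    rw [show (-2 * Real.pi * ξ * Complex.I * b : ℂ) = -2 * Real.pi * ξ * Complex.I * a -
      Real.pi * Complex.I - k * (2 * Real.pi * Complex.I) by
        linear_combination (-2 * Real.pi * Complex.I) * hk', Complex.exp_sub, Complex.exp_sub,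
        Complex.exp_pi_mul_I, Complex.exp_nat_mul_two_pi_mul_I, div_one, div_neg, div_one]
  have h2 : ‖Complex.exp (-2 * Real.pi * ξ * Complex.I * a)‖ = 1 := by
    rw [show (-2 * Real.pi * ξ * Complex.I * a : ℂ) = ((-2 * Real.pi * ξ * a : ℝ) : ℂ) *
      Complex.I by push_cast; ring, Complex.norm_exp_ofReal_mul_I]
  rw [h1, ← neg_add', norm_neg, ← two_mul, norm_mul, h2]
  simp only [norm_mul, norm_neg, Complex.norm_ofNat, Complex.norm_real, Complex.norm_I, mul_one,
    Real.norm_eq_abs, abs_of_pos Real.pi_pos, abs_of_pos hξ]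
  have := Real.pi_pos
  field_simp

/-! ### Lower bounds for the excess. -/

section LowerBounds
variable {α : ℂ} {I : Set ℝ} {a b δ : ℝ} {G : ℂ → ℂ}

lemma integrable_indicator_of_ae_eq_Icc (hI : I =ᵐ[volume] Set.Icc a b) :
    Integrable (I.indicator fun _ => (1 : ℝ)) := by
  refine Integrable.congr ?_ (indicator_ae_eq_of_ae_eq_set hI.symm)
  exact (integrable_indicator_iff measurableSet_Icc).2 (by simp)

lemma integral_indicator_of_ae_eq_Icc (hI : I =ᵐ[volume] Set.Icc a b) (hab : a ≤ b) :
    ∫ t, I.indicator (fun _ => (1 : ℝ)) t = b - a := by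
  rw [integral_congr_ae (indicator_ae_eq_of_ae_eq_set hI),
    integral_indicator measurableSet_Icc]
  simp [hab]

namespace IsAdmissibleMajorant

lemma re_nonneg (h : IsAdmissibleMajorant α I δ G) (t : ℝ) : 0 ≤ (G t).re :=
  (Set.indicator_nonneg (fun _ _ => zero_le_one) t).trans (h.majorant t)

lemma norm_eq (h : IsAdmissibleMajorant α I δ G) (t : ℝ) : ‖G t‖ = (G t).re := by
  rw [show G t = ((G t).re : ℂ) from Complex.ext rfl (by simp [h.real_valued t]), Complex.norm_real,
    Real.norm_eq_abs, Complex.ofReal_re, abs_of_nonneg (h.re_nonneg t)]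

lemma excess_nonneg (h : IsAdmissibleMajorant α I δ G) :
    0 ≤ ∫ t : ℝ, ((G t).re - I.indicator (fun _ => (1 : ℝ)) t) :=
  integral_nonneg fun t => sub_nonneg.2 (h.majorant t)

lemma integral_norm_eq (h : IsAdmissibleMajorant α I δ G) (hI : I =ᵐ[volume] Set.Icc a b)
    (hab : a ≤ b) : ∫ t : ℝ, ‖G t‖ =
      (∫ t : ℝ, ((G t).re - I.indicator (fun _ => (1 : ℝ)) t)) + (b - a) := by
  simp_rw [h.norm_eq]
  rw [integral_sub (by simpa using h.integrable.re) (integrable_indicator_of_ae_eq_Icc hI),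
    integral_indicator_of_ae_eq_Icc hI hab]
  ring

lemma one_le_norm (h : IsAdmissibleMajorant α I δ G) {t : ℝ} (ht : t ∈ I) : 1 ≤ ‖G t‖ := by
  rw [h.norm_eq]
  simpa [ht] using h.majorant t

/-- The transform of the indicator function bounds the excess from below off the band. -/
lemma norm_fourier_indicator_le (h : IsAdmissibleMajorant α I δ G) (hI : I =ᵐ[volume] Set.Icc a b)
    {ξ : ℝ} (hξ : δ < |ξ|) : ‖𝓕 ((Set.Icc a b).indicator fun _ => (1 : ℂ)) ξ‖ ≤
      ∫ t : ℝ, ((G t).re - I.indicator (fun _ => (1 : ℝ)) t) := by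
  have hint : Integrable ((Set.Icc a b).indicator fun _ => (1 : ℂ)) :=
    (integrable_indicator_iff measurableSet_Icc).2 (by simp)
  -- Off the band Ĝ vanishes, so the transform of χ_I is minus that of G − χ_I, whose L¹ norm is the
  -- excess because G ≥ χ_I.
  have h0 : 𝓕 ((Set.Icc a b).indicator fun _ => (1 : ℂ)) ξ =
      - 𝓕 (fun t : ℝ => G t - (Set.Icc a b).indicator (fun _ => (1 : ℂ)) t) ξ := by
    have h1 := h.fourier_eq_zero ξ hξ
    rw [Real.fourier_eq] at h1 ⊢
    rw [Real.fourier_eq]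
    simp_rw [smul_sub]
    rw [integral_sub, h1]
    · ring
    · exact (Real.fourierIntegral_convergent_iff ξ).2 h.integrable
    · exact (Real.fourierIntegral_convergent_iff ξ).2 hint
  rw [h0, norm_neg]
  refine (norm_fourier_le _ _).trans (le_of_eq (integral_congr_ae ?_))
  filter_upwards [indicator_ae_eq_of_ae_eq_set (f := fun _ => (1 : ℝ)) hI] with t ht
  have h2 := h.majorant t
  rw [ht] at h2 ⊢
  have h3 : G t - (Set.Icc a b).indicator (fun _ => (1 : ℂ)) t =
      (((G t).re - (Set.Icc a b).indicator (fun _ => (1 : ℝ)) t : ℝ) : ℂ) := by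
    by_cases ht : t ∈ Set.Icc a b
    · simp only [Set.indicator_of_mem ht]
      exact Complex.ext (by simp) (by simp [h.real_valued t])
    · simp only [Set.indicator_of_notMem ht]
      exact Complex.ext (by simp) (by simp [h.real_valued t])
  rw [h3, Complex.norm_real, Real.norm_of_nonneg (sub_nonneg.2 h2)]

/-- If (b − a)δ ≤ 1/4, then 1 ≤ 2δ(E + b − a) already gives E ≥ 1/(4δ). Otherwise the transform of
the indicator is evaluated at a frequency between δ and 5δ; the constant 20 is 5 times the bound 4
for π. -/
lemma excess_ge_of_large_bandwidth (h : IsAdmissibleMajorant α I δ G) (hδ : 0 < δ)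
    (hI : I =ᵐ[volume] Set.Icc a b) (hab : a ≤ b) (hne : I.Nonempty) :
    20⁻¹ * δ⁻¹ ≤ ∫ t : ℝ, ((G t).re - I.indicator (fun _ => (1 : ℝ)) t) := by
  obtain ⟨t, ht⟩ := hne
  rcases le_or_gt ((b - a) * δ) (1 / 4) with hs | hs
  · have h1 := (h.one_le_norm ht).trans (norm_le_of_bandlimited hδ h.entire h.integrable
      h.fourier_eq_zero t)
    rw [h.integral_norm_eq hI hab] at h1
    rw [← div_eq_mul_inv, div_le_iff₀ hδ]
    nlinarith
  · have hL : 0 < b - a := by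
      by_contra hL
      nlinarith
    -- k + 1/2 is the first half-integer beyond δ(b − a); thus ξ = (k + 1/2)/(b − a) exceeds δ by at
    -- most 1/(b − a) < 4δ.
    obtain ⟨k, hk1, hk2⟩ : ∃ k : ℕ, δ * (b - a) < k + 1 / 2 ∧ (k : ℝ) + 1 / 2 ≤ δ * (b - a) + 1 :=
      ⟨⌊δ * (b - a) + 1 / 2⌋₊, by linarith [Nat.lt_floor_add_one (δ * (b - a) + 1 / 2)],
        by linarith [Nat.floor_le (show 0 ≤ δ * (b - a) + 1 / 2 by positivity)]⟩
    have hξ : 0 < (k + 1 / 2 : ℝ) / (b - a) := by positivity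
    have h1 := h.norm_fourier_indicator_le hI (ξ := (k + 1 / 2 : ℝ) / (b - a)) (by
      rw [abs_of_pos hξ, lt_div_iff₀ hL]; exact hk1)
    rw [norm_fourier_indicator_Icc hab hξ (k := k) (by field_simp)] at h1
    refine le_trans ?_ h1
    rw [← mul_inv]
    refine inv_anti₀ (by positivity) ?_
    have h2 : (k + 1 / 2 : ℝ) / (b - a) ≤ 5 * δ := by
      rw [div_le_iff₀ hL]; nlinarith
    have := Real.pi_le_four
    nlinarith [Real.pi_pos]

/-- G falls from at least 1 at a point of I to 0 at α, both in the disc of radius R; the increment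
bound then makes ‖G‖₁ large, and b − a ≤ 2R is subtracted. -/
lemma excess_ge_of_small_bandwidth {R : ℝ} (h : IsAdmissibleMajorant α I δ G) (hδ : 0 < δ)
    (hR : 1 ≤ R) (hδR : 14 * R * δ ≤ 1) (hα : ‖α‖ ≤ R) (hI : I =ᵐ[volume] Set.Icc a b) (hab : a ≤ b)
    (hne : I.Nonempty) (ha : -R ≤ a) (hb : b ≤ R) (hIR : I ⊆ Set.Icc (-R) R) :
    (160 * R)⁻¹ * (δ ^ 2)⁻¹ - 2 * R ≤
      ∫ t : ℝ, ((G t).re - I.indicator (fun _ => (1 : ℝ)) t) := by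
  obtain ⟨t, ht⟩ := hne
  have h1 := norm_sub_le_of_bandlimited hδ h.entire h.integrable h.fourier_eq_zero
    (z := t) (w := α) (R := R) (by simpa [abs_le] using hIR ht) hα
  rw [h.vanishing, sub_zero, h.integral_norm_eq hI hab] at h1
  replace h1 := (h.one_le_norm ht).trans h1
  have hE := h.excess_nonneg
  set E := ∫ t : ℝ, ((G t).re - I.indicator (fun _ => (1 : ℝ)) t)
  have h2 : Real.exp (2 * Real.pi * δ * R) ≤ 3 := by
    refine (Real.exp_le_exp.2 (show _ ≤ (1 : ℝ) from ?_)).trans Real.exp_one_lt_three.le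
    nlinarith [mul_pos hδ (zero_lt_one.trans_le hR), Real.pi_lt_d2, mul_pos (mul_pos hδ (zero_lt_one.trans_le hR)) (sub_pos.2 Real.pi_lt_d2)]
  -- The product of the constants is 96, which leaves room for 160 in the conclusion.
  have h3 : 1 ≤ (E + 2 * R) * (3 * (2 * 4 * δ * (2 * R))) * (2 * δ) := by
    refine h1.trans ?_
    have := Real.pi_le_four
    have := Real.pi_pos
    gcongr
    linarith
  rw [← mul_inv, sub_le_iff_le_add, inv_le_iff_one_le_mul₀ (by positivity)]
  have : 0 ≤ (E + 2 * R) * R * δ ^ 2 := by positivity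
  nlinarith

end IsAdmissibleMajorant
end LowerBounds

/-! ### Entire functions of exponential type with quadratic decay. -/

/-- `G` is entire of exponential type `τ`, with quadratic decay along horizontal lines. -/
structure HasExpTypeDecay (τ : ℝ) (G : ℂ → ℂ) : Prop where
  differentiable : Differentiable ℂ G
  bound : ∃ C, ∀ z, ‖G z‖ ≤ C * Real.exp (τ * |z.im|) * (1 + z.re ^ 2)⁻¹

/-- Shifting the line of integration for an entire function with quadratic decay in a strip. -/
lemma integral_add_mul_I_eq {h : ℂ → ℂ} (hd : Differentiable ℂ h) {D y : ℝ}
    (hb : ∀ x : ℝ, ∀ v ∈ Set.uIcc 0 y, ‖h (x + v * Complex.I)‖ ≤ D * (1 + x ^ 2)⁻¹) :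
    ∫ x : ℝ, h (x + y * Complex.I) = ∫ x : ℝ, h x := by
  have hint : ∀ v ∈ Set.uIcc 0 y, Integrable fun x : ℝ => h (x + v * Complex.I) := fun v hv =>
    (integrable_inv_one_add_sq.const_mul D).mono'
      (Continuous.aestronglyMeasurable (hd.continuous.comp (by fun_prop)))
      (.of_forall fun x => hb x v hv)
  have h0 := hint 0 (by simp)
  have hy := hint y (by simp)
  simp only [Complex.ofReal_zero, zero_mul, add_zero] at h0
  have t0 := intervalIntegral_tendsto_integral h0 Filter.tendsto_neg_atTop_atBot Filter.tendsto_id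
  have ty := intervalIntegral_tendsto_integral hy Filter.tendsto_neg_atTop_atBot Filter.tendsto_id
  have key : ∀ T : ℝ, ‖(∫ x in (-T)..T, h x) - ∫ x in (-T)..T, h (x + y * Complex.I)‖ ≤
      2 * (D * (1 + T ^ 2)⁻¹ * |y|) := by
    intro T
    have hC := Complex.integral_boundary_rect_eq_zero_of_differentiableOn h (-T : ℝ)
      (T + y * Complex.I) hd.differentiableOn
    simp only [Complex.ofReal_im, Complex.ofReal_zero, zero_mul, add_zero, Complex.ofReal_re,
      Complex.add_re, Complex.mul_re, Complex.I_re, mul_zero, Complex.I_im, mul_one,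
      Complex.add_im, Complex.mul_im, zero_add, smul_eq_mul, sub_self] at hC
    have e : (∫ x in (-T)..T, h x) - ∫ x in (-T)..T, h (x + y * Complex.I) =
        Complex.I * (∫ v in (0 : ℝ)..y, h ((-T : ℝ) + v * Complex.I)) -
        Complex.I * ∫ v in (0 : ℝ)..y, h (T + v * Complex.I) := by
      linear_combination hC
    have hv : ∀ S : ℝ, S ^ 2 = T ^ 2 → ‖∫ v in (0 : ℝ)..y, h (S + v * Complex.I)‖ ≤
        D * (1 + T ^ 2)⁻¹ * |y| := fun S hS => by
      have := intervalIntegral.norm_integral_le_of_norm_le_const (a := 0) (b := y)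
        (f := fun v : ℝ => h (S + v * Complex.I)) (C := D * (1 + T ^ 2)⁻¹)
        fun v hv => hS ▸ hb S v (Set.uIoc_subset_uIcc hv)
      simpa using this
    rw [e]
    refine (norm_sub_le _ _).trans ?_
    rw [norm_mul, norm_mul, Complex.norm_I, one_mul, one_mul, two_mul]
    exact add_le_add (hv _ (by ring)) (hv _ rfl)
  have hz : Filter.Tendsto (fun T : ℝ => 2 * (D * (1 + T ^ 2)⁻¹ * |y|)) Filter.atTop (nhds 0) := by
    have : Filter.Tendsto (fun T : ℝ => (1 + T ^ 2)⁻¹) Filter.atTop (nhds 0) :=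
      (Filter.tendsto_atTop_add_const_left _ _ (Filter.tendsto_pow_atTop two_ne_zero)
        ).inv_tendsto_atTop
    simpa using ((this.const_mul D).mul_const |y|).const_mul 2
  have hz' := squeeze_zero_norm key hz
  exact (sub_eq_zero.1 (tendsto_nhds_unique (t0.sub ty) hz')).symm

namespace HasExpTypeDecay
variable {τ σ : ℝ} {F G : ℂ → ℂ}

lemma exists_nonneg_bound (h : HasExpTypeDecay τ G) :
    ∃ C, 0 ≤ C ∧ ∀ z, ‖G z‖ ≤ C * Real.exp (τ * |z.im|) * (1 + z.re ^ 2)⁻¹ := by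
  obtain ⟨C, hC⟩ := h.bound
  refine ⟨C, ?_, hC⟩
  simpa using (norm_nonneg _).trans (hC 0)

lemma mono (h : HasExpTypeDecay τ G) (hτ : τ ≤ σ) : HasExpTypeDecay σ G := by
  obtain ⟨C, hC0, hC⟩ := h.exists_nonneg_bound
  exact ⟨h.differentiable, C, fun z => (hC z).trans (by gcongr)⟩

lemma add (hF : HasExpTypeDecay τ F) (hG : HasExpTypeDecay τ G) :
    HasExpTypeDecay τ fun z => F z + G z := by
  obtain ⟨C, hC⟩ := hF.bound
  obtain ⟨D, hD⟩ := hG.bound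
  refine ⟨hF.differentiable.add hG.differentiable, C + D, fun z => (norm_add_le _ _).trans ?_⟩
  rw [add_mul, add_mul]
  exact add_le_add (hC z) (hD z)

lemma const_mul (hF : HasExpTypeDecay τ F) (c : ℂ) : HasExpTypeDecay τ fun z => c * F z := by
  obtain ⟨C, hC⟩ := hF.bound
  refine ⟨hF.differentiable.const_mul c, ‖c‖ * C, fun z => ?_⟩
  rw [norm_mul, mul_assoc, mul_assoc, ← mul_assoc C]
  exact mul_le_mul_of_nonneg_left (hC z) (norm_nonneg _)

lemma comp_affine (hF : HasExpTypeDecay τ F) {r : ℝ} (hr : 0 < r) (c : ℝ) :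
    HasExpTypeDecay (τ * r) fun z => F (r * z + c) := by
  obtain ⟨C, hC0, hC⟩ := hF.exists_nonneg_bound
  refine ⟨hF.differentiable.comp (by fun_prop), C * (1 + 2 * (1 + c ^ 2) / r ^ 2), fun z => ?_⟩
  have h1 := hC (r * z + c)
  simp only [Complex.add_im, Complex.re_ofReal_mul, Complex.im_ofReal_mul, Complex.ofReal_im,
    add_zero, Complex.add_re, Complex.ofReal_re, abs_mul, abs_of_pos hr, ← mul_assoc] at h1
  refine h1.trans ?_
  have h2 : (1 + (r * z.re + c) ^ 2)⁻¹ ≤ (1 + 2 * (1 + c ^ 2) / r ^ 2) * (1 + z.re ^ 2)⁻¹ := by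
    rw [inv_le_iff_one_le_mul₀ (by positivity), mul_right_comm, ← div_eq_mul_inv,
      le_div_iff₀ (by positivity), one_mul]
    have h3 : z.re ^ 2 ≤ 2 * (1 + c ^ 2) / r ^ 2 * (1 + (r * z.re + c) ^ 2) := by
      rw [div_mul_eq_mul_div, le_div_iff₀ (by positivity)]
      nlinarith [sq_nonneg (r * z.re + c + c), mul_nonneg (sq_nonneg c) (sq_nonneg (r * z.re + c)),
        sq_nonneg (r * z.re + 2 * c)]
    nlinarith [sq_nonneg (r * z.re + c)]
  calc C * Real.exp (τ * r * |z.im|) * (1 + (r * z.re + c) ^ 2)⁻¹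
      ≤ C * Real.exp (τ * r * |z.im|) * ((1 + 2 * (1 + c ^ 2) / r ^ 2) * (1 + z.re ^ 2)⁻¹) := by
        gcongr
    _ = _ := by ring

lemma intervalIntegral_comp_sub (hF : HasExpTypeDecay τ F) (a b : ℝ) :
    HasExpTypeDecay τ fun z => ∫ u in a..b, F (z - u) := by
  obtain ⟨C, hC0, hC⟩ := hF.exists_nonneg_bound
  have hd := hF.differentiable
  refine ⟨?_, C * (2 * (1 + (|a| + |b|) ^ 2)) * |b - a|, fun z => ?_⟩
  · have hc' : Continuous (deriv F) := (hd.contDiff (n := 1)).continuous_deriv le_rfl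
    refine differentiable_intervalIntegral (F := fun z u => F (z - u))
      (F' := fun z u => deriv F (z - u)) ?_ ?_ (fun z u => ?_) a b
    · exact hd.continuous.comp (by fun_prop)
    · exact hc'.comp (by fun_prop)
    · exact (hd (z - u)).hasDerivAt.comp_sub_const z u
  · refine (intervalIntegral.norm_integral_le_of_norm_le_const
      (C := C * (2 * (1 + (|a| + |b|) ^ 2)) * Real.exp (τ * |z.im|) * (1 + z.re ^ 2)⁻¹)
      (fun u hu => ?_)).trans (le_of_eq (by ring))
    have h1 := hC (z - u)
    simp only [Complex.sub_im, Complex.ofReal_im, sub_zero, Complex.sub_re,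
      Complex.ofReal_re] at h1
    refine h1.trans ?_
    have hu' : u ^ 2 ≤ (|a| + |b|) ^ 2 := by
      refine sq_le_sq' ?_ ?_
      · rcases Set.mem_uIcc.1 (Set.uIoc_subset_uIcc hu) with h | h <;>
          linarith [neg_abs_le a, neg_abs_le b, abs_nonneg a, abs_nonneg b, h.1]
      · rcases Set.mem_uIcc.1 (Set.uIoc_subset_uIcc hu) with h | h <;>
          linarith [le_abs_self a, le_abs_self b, abs_nonneg a, abs_nonneg b, h.2]
    have h2 : (1 + (z.re - u) ^ 2)⁻¹ ≤ (2 * (1 + (|a| + |b|) ^ 2)) * (1 + z.re ^ 2)⁻¹ := by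
      rw [inv_le_iff_one_le_mul₀ (by positivity), mul_right_comm, ← div_eq_mul_inv,
        le_div_iff₀ (by positivity), one_mul]
      nlinarith [sq_nonneg (z.re - 2 * u), mul_nonneg (sub_nonneg.2 hu') (sq_nonneg (z.re - u)),
        mul_nonneg (sq_nonneg u) (sq_nonneg (z.re - u)), sq_nonneg (z.re - u)]
    calc C * Real.exp (τ * |z.im|) * (1 + (z.re - u) ^ 2)⁻¹
        ≤ C * Real.exp (τ * |z.im|) * ((2 * (1 + (|a| + |b|) ^ 2)) * (1 + z.re ^ 2)⁻¹) := by
          gcongr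
      _ = _ := by ring

lemma integrable (hF : HasExpTypeDecay τ F) : Integrable fun t : ℝ => F t := by
  obtain ⟨C, hC⟩ := hF.bound
  exact (integrable_inv_one_add_sq.const_mul C).mono'
    (hF.differentiable.continuous.comp Complex.continuous_ofReal).aestronglyMeasurable
    (.of_forall fun x => by simpa using hC x)

/-- The easy direction of the Paley–Wiener theorem. -/
lemma fourier_eq_zero (hF : HasExpTypeDecay τ F) (hτ : 0 ≤ τ) {ξ : ℝ}
    (hξ : τ < 2 * Real.pi * |ξ|) : 𝓕 (fun t : ℝ => F t) ξ = 0 := by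
  obtain ⟨C, hC0, hC⟩ := hF.exists_nonneg_bound
  set h : ℂ → ℂ := fun z => Complex.exp (-2 * Real.pi * ξ * Complex.I * z) * F z
  have hd : Differentiable ℂ h := by
    have := hF.differentiable
    fun_prop
  have hn : ∀ x v : ℝ, ‖h (x + v * Complex.I)‖ ≤
      C * Real.exp (τ * |v| + 2 * Real.pi * ξ * v) * (1 + x ^ 2)⁻¹ := fun x v => by
    have h1 := hC (x + v * Complex.I)
    simp only [Complex.add_im, Complex.ofReal_im, Complex.mul_im, Complex.ofReal_re, Complex.I_im,
      mul_one, Complex.I_re, mul_zero, add_zero, zero_add, Complex.add_re, Complex.mul_re,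
      sub_zero] at h1
    have h2 : ‖Complex.exp (-2 * Real.pi * ξ * Complex.I * (x + v * Complex.I))‖ =
        Real.exp (2 * Real.pi * ξ * v) := by
      rw [Complex.norm_exp]; congr 1; simp
    change ‖_ * _‖ ≤ _
    rw [norm_mul, h2, Real.exp_add]
    calc _ ≤ Real.exp (2 * Real.pi * ξ * v) * (C * Real.exp (τ * |v|) * (1 + x ^ 2)⁻¹) := by gcongr
      _ = _ := by ring
  -- Moving the line to height y costs exp(τ|y| + 2πξy). For y of sign opposite to ξ and |y| → ∞
  -- this tends to 0, since τ < 2π|ξ|.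
  have hshift : ∀ y : ℝ, ‖∫ x : ℝ, h x‖ ≤
      C * Real.exp (τ * |y| + 2 * Real.pi * ξ * y) * Real.pi := fun y => by
    rw [← integral_add_mul_I_eq hd (D := C * Real.exp (τ * |y| + |2 * Real.pi * ξ| * |y|)) (y := y)
      fun x v hv => ?_]
    · refine (norm_integral_le_of_norm_le (integrable_inv_one_add_sq.const_mul _)
        (.of_forall fun x => hn x y)).trans ?_
      rw [integral_const_mul, integral_univ_inv_one_add_sq]
    · refine (hn x v).trans ?_
      have hv' : |v| ≤ |y| := by
        simpa using Set.abs_sub_left_of_mem_uIcc hv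
      have h3 : 2 * Real.pi * ξ * v ≤ |2 * Real.pi * ξ| * |y| :=
        (le_abs_self _).trans (by rw [abs_mul]; gcongr)
      gcongr
  have hF0 : 𝓕 (fun t : ℝ => F t) ξ = ∫ x : ℝ, h x := by
    rw [Real.fourier_real_eq_integral_exp_smul]
    congr 1 with t
    simp only [smul_eq_mul, h]
    congr 2; push_cast; ring
  rw [hF0, ← norm_le_zero_iff]
  have hlim : Filter.Tendsto (fun T : ℝ => C * Real.exp (-((2 * Real.pi * |ξ| - τ) * T)) * Real.pi)
      Filter.atTop (nhds 0) := by
    have := Real.tendsto_exp_neg_atTop_nhds_zero.comp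
      (Filter.tendsto_id.const_mul_atTop (sub_pos.2 hξ))
    simpa using (this.const_mul C).mul_const Real.pi
  refine ge_of_tendsto hlim ((Filter.eventually_ge_atTop 0).mono fun T hT => ?_)
  rcases le_total 0 ξ with h0 | h0
  · refine (hshift (-T)).trans (le_of_eq ?_)
    rw [abs_neg, abs_of_nonneg hT, abs_of_nonneg h0]
    congr 3; ring
  · refine (hshift T).trans (le_of_eq ?_)
    rw [abs_of_nonneg hT, abs_of_nonpos h0]
    congr 3; ring

lemma isAdmissibleMajorant {α : ℂ} {I : Set ℝ} {δ : ℝ} (hF : HasExpTypeDecay τ F) (hτ : 0 ≤ τ)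
    (hδ : τ ≤ 2 * Real.pi * δ) {f : ℝ → ℝ} (hf : ∀ t : ℝ, F t = f t)
    (hI : ∀ t, I.indicator (fun _ => (1 : ℝ)) t ≤ f t) (hα : F α = 0) :
    IsAdmissibleMajorant α I δ F where
  entire := hF.differentiable
  integrable := hF.integrable
  real_valued t := by simp [hf]
  majorant t := by simpa [hf] using hI t
  fourier_eq_zero ξ hξ := hF.fourier_eq_zero hτ (hδ.trans_lt (by
    have := Real.pi_pos
    gcongr))
  vanishing := hα

end HasExpTypeDecay

/-! ### The entire sinc function and its powers. -/

/-- The entire function `sin z / z`. -/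
noncomputable def Complex.sinc : ℂ → ℂ := dslope Complex.sin 0

namespace Complex

lemma differentiable_sinc : Differentiable ℂ sinc :=
  differentiableOn_univ.1
    ((Complex.differentiableOn_dslope (by simp)).2 Complex.differentiable_sin.differentiableOn)

lemma mul_sinc (z : ℂ) : z * sinc z = sin z := by
  simpa [sinc] using sub_smul_dslope Complex.sin 0 z

lemma sinc_ofReal (t : ℝ) : sinc t = (Real.sinc t : ℂ) := by
  rcases eq_or_ne t 0 with rfl | ht
  · simp [sinc]
  · have ht' : (t : ℂ) ≠ 0 := by exact_mod_cast ht
    apply mul_left_cancel₀ ht'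
    rw [mul_sinc, Real.sinc_of_ne_zero ht]
    push_cast
    field_simp

lemma norm_exp_mul_I_le (z : ℂ) : ‖exp (z * I)‖ ≤ Real.exp |z.im| := by
  rw [norm_exp]
  simpa using neg_le_abs z.im

lemma norm_cos_le (z : ℂ) : ‖cos z‖ ≤ Real.exp |z.im| := by
  have h1 := norm_exp_mul_I_le z
  have h2 := norm_exp_mul_I_le (-z)
  simp only [neg_im, abs_neg] at h2
  rw [Complex.cos, norm_div, Complex.norm_ofNat]
  have := norm_add_le (exp (z * I)) (exp (-z * I))
  linarith

lemma norm_sin_le (z : ℂ) : ‖sin z‖ ≤ Real.exp |z.im| := by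
  have h1 := norm_exp_mul_I_le z
  have h2 := norm_exp_mul_I_le (-z)
  simp only [neg_im, abs_neg] at h2
  rw [Complex.sin, norm_div, Complex.norm_ofNat, norm_mul, Complex.norm_I, mul_one]
  have := norm_sub_le (exp (-z * I)) (exp (z * I))
  linarith

/-- Reverse triangle inequality for the two exponentials. It serves to show that sinc(δα) is
exponentially large. -/
lemma sinh_abs_im_le_norm_sin (z : ℂ) : Real.sinh |z.im| ≤ ‖sin z‖ := by
  have h1 : ‖exp (z * I)‖ = Real.exp (-z.im) := by rw [norm_exp]; simp
  have h2 : ‖exp (-z * I)‖ = Real.exp z.im := by rw [norm_exp]; simp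
  rw [Complex.sin, norm_div, Complex.norm_ofNat, norm_mul, Complex.norm_I, mul_one]
  have h3 := abs_norm_sub_norm_le (exp (-z * I)) (exp (z * I))
  rw [h1, h2] at h3
  rw [← Real.abs_sinh, Real.sinh_eq, abs_div, abs_two]
  gcongr

/-- Mean value inequality for sin on the segment from 0 to z, along which the imaginary part is at
most |Im z| in modulus. -/
lemma norm_sinc_le (z : ℂ) : ‖sinc z‖ ≤ Real.exp |z.im| := by
  rcases eq_or_ne z 0 with rfl | hz
  · simp [sinc]
  have h : ‖sin z - sin 0‖ ≤ Real.exp |z.im| * ‖z - 0‖ := by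
    refine (convex_segment (𝕜 := ℝ) (0 : ℂ) z).norm_image_sub_le_of_norm_deriv_le (𝕜 := ℂ)
      (fun w _ => Complex.differentiableAt_sin) (fun w hw => ?_) (left_mem_segment ℝ _ _)
      (right_mem_segment ℝ _ _)
    rw [Complex.deriv_sin]
    refine (norm_cos_le w).trans (Real.exp_le_exp.2 ?_)
    obtain ⟨θ, ⟨h0, h1⟩, rfl⟩ := (segment_eq_image ℝ (0 : ℂ) z) ▸ hw
    simp only [smul_zero, zero_add, real_smul, im_ofReal_mul, abs_mul, abs_of_nonneg h0]
    exact mul_le_of_le_one_left (abs_nonneg _) h1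
  rw [sin_zero, sub_zero, sub_zero, ← mul_sinc, norm_mul, mul_comm] at h
  exact le_of_mul_le_mul_right h (norm_pos_iff.2 hz)

lemma norm_sinc_sq_mul_le (z : ℂ) :
    ‖sinc z‖ ^ 2 * (1 + ‖z‖ ^ 2) ≤ 2 * Real.exp (2 * |z.im|) := by
  have h1 := norm_sinc_le z
  have h2 := norm_sin_le z
  rw [← mul_sinc, norm_mul] at h2
  rw [mul_comm 2 |z.im|, Real.exp_mul, Real.rpow_ofNat]
  have h3 := pow_le_pow_left₀ (norm_nonneg _) h1 2
  have h4 := pow_le_pow_left₀ (by positivity) h2 2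
  nlinarith

end Complex

lemma Complex.re_sq_le_norm_sq (z : ℂ) : z.re ^ 2 ≤ ‖z‖ ^ 2 := by
  rw [← sq_abs]
  exact pow_le_pow_left₀ (abs_nonneg _) (Complex.abs_re_le_norm z) 2

lemma hasExpTypeDecay_sinc_sq : HasExpTypeDecay 2 fun z => Complex.sinc z ^ 2 := by
  refine ⟨Complex.differentiable_sinc.pow 2, 2, fun z => ?_⟩
  rw [← div_eq_mul_inv, le_div_iff₀ (by positivity), norm_pow]
  refine le_trans ?_ (Complex.norm_sinc_sq_mul_le z)
  exact mul_le_mul_of_nonneg_left (add_le_add_right (Complex.re_sq_le_norm_sq z) 1) (by positivity)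

/-- Each factor sinc² absorbs one factor 1 + |z|²: the first pays for the growth of P, the second
provides the decay. -/
lemma hasExpTypeDecay_mul_sinc_pow_four {P : ℂ → ℂ} (hP : Differentiable ℂ P) {D : ℝ}
    (hD : ∀ z, ‖P z‖ ≤ D * (1 + ‖z‖ ^ 2)) :
    HasExpTypeDecay 4 fun z => P z * Complex.sinc z ^ 4 := by
  refine ⟨hP.mul (Complex.differentiable_sinc.pow 4), D * 4, fun z => ?_⟩
  rw [← div_eq_mul_inv, le_div_iff₀ (by positivity), norm_mul, norm_pow]
  have hD0 : 0 ≤ D := by simpa using (norm_nonneg _).trans (hD 0)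
  have h1 := pow_le_pow_left₀ (by positivity) (Complex.norm_sinc_sq_mul_le z) 2
  calc ‖P z‖ * ‖Complex.sinc z‖ ^ 4 * (1 + z.re ^ 2)
      ≤ (D * (1 + ‖z‖ ^ 2)) * ‖Complex.sinc z‖ ^ 4 * (1 + ‖z‖ ^ 2) := by
        gcongr ?_ * _ * (1 + ?_)
        · exact hD z
        · exact Complex.re_sq_le_norm_sq z
    _ = D * (‖Complex.sinc z‖ ^ 2 * (1 + ‖z‖ ^ 2)) ^ 2 := by ring
    _ ≤ D * (2 * Real.exp (2 * |z.im|)) ^ 2 := by gcongr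
    _ = D * 4 * Real.exp (4 * |z.im|) := by
        rw [mul_pow, ← Real.exp_nat_mul]; ring_nf

lemma hasExpTypeDecay_sinc_pow_four : HasExpTypeDecay 4 fun z => Complex.sinc z ^ 4 := by
  simpa using hasExpTypeDecay_mul_sinc_pow_four (P := fun _ => 1) (differentiable_const 1) (D := 1)
    fun z => by simp

lemma integrable_sinc_sq : Integrable fun t : ℝ => Real.sinc t ^ 2 := by
  refine hasExpTypeDecay_sinc_sq.integrable.re.congr (.of_forall fun t => ?_)
  simp only [Complex.sinc_ofReal, ← Complex.ofReal_pow, RCLike.re_to_complex, Complex.ofReal_re]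

lemma integrable_sinc_pow_four : Integrable fun t : ℝ => Real.sinc t ^ 4 := by
  refine hasExpTypeDecay_sinc_pow_four.integrable.re.congr (.of_forall fun t => ?_)
  simp only [Complex.sinc_ofReal, ← Complex.ofReal_pow, RCLike.re_to_complex, Complex.ofReal_re]

lemma integrable_one_add_sq_mul_sinc_pow_four :
    Integrable fun t : ℝ => (1 + t ^ 2) * Real.sinc t ^ 4 := by
  have h := hasExpTypeDecay_mul_sinc_pow_four (P := fun z => 1 + z ^ 2) (by fun_prop) (D := 1)
    fun z => by rw [one_mul]; exact (norm_add_le _ _).trans (by simp)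
  refine h.integrable.re.congr (.of_forall fun t => ?_)
  simp only [Complex.sinc_ofReal]
  norm_cast

/-! ### Upper bound for small bandwidth. -/

lemma excess_eq {I : Set ℝ} {a b : ℝ} (hI : I =ᵐ[volume] Set.Icc a b) (hab : a ≤ b)
    {G : ℂ → ℂ} {f : ℝ → ℝ} (hf : ∀ t : ℝ, G t = f t) (hint : Integrable f) :
    ∫ t : ℝ, ((G t).re - I.indicator (fun _ => (1 : ℝ)) t) = (∫ t, f t) - (b - a) := by
  simp_rw [hf, Complex.ofReal_re]
  rw [integral_sub hint (integrable_indicator_of_ae_eq_Icc hI),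
    integral_indicator_of_ae_eq_Icc hI hab]

lemma half_le_sinc {x : ℝ} (hx : |x| ≤ 1) : 1 / 2 ≤ Real.sinc x := by
  have habs : Real.sinc |x| = Real.sinc x := by
    rcases abs_choice x with h | h <;> rw [h]
    exact Real.sinc_neg x
  rw [← habs]
  rcases (abs_nonneg x).eq_or_lt with h | h
  · rw [← h]; norm_num
  · rw [Real.sinc_of_ne_zero h.ne', le_div_iff₀ h]
    have h1 := Real.sin_gt_sub_cube h
    nlinarith [mul_nonneg h.le (sub_nonneg.2 (pow_le_one₀ (n := 2) h.le hx))]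

/-- For small bandwidth, a quadratic times a power of `sinc` is an admissible majorant. -/
lemma exists_admissible_of_small_bandwidth {α : ℂ} {I : Set ℝ} {a b δ R : ℝ} (hδ : 0 < δ)
    (hR : 1 ≤ R) (hδR : δ * R ≤ 1) (hα : ‖α‖ ≤ R) (hα' : 1 ≤ R * α.im)
    (hI : I =ᵐ[volume] Set.Icc a b) (hab : a ≤ b) (hIR : I ⊆ Set.Icc (-R) R) :
    ∃ G, IsAdmissibleMajorant α I δ G ∧
      ∫ t : ℝ, ((G t).re - I.indicator (fun _ => (1 : ℝ)) t) ≤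
        32 * R ^ 4 * (∫ t, (1 + t ^ 2) * Real.sinc t ^ 4) * (δ ^ 3)⁻¹ := by
  have hR0 : 0 < R := one_pos.trans_le hR
  have hδ1 : δ ≤ 1 := by nlinarith
  -- On the line the two linear factors multiply to |t − α|² ≥ (Im α)² ≥ R⁻², and sinc(δt)⁴ ≥ 1/16
  -- on I because δ|t| ≤ 1; hence the factor 16R².
  set G : ℂ → ℂ := fun z => (16 * R ^ 2 : ℝ) *
    ((z - α) * (z - (starRingEnd ℂ) α) * Complex.sinc (δ * z) ^ 4) with hGdef
  set f : ℝ → ℝ := fun t => 16 * R ^ 2 * (((t - α.re) ^ 2 + α.im ^ 2) * Real.sinc (δ * t) ^ 4)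
  have hf : ∀ t : ℝ, G t = f t := fun t => by
    have h1 : ((t : ℂ) - α) * (t - (starRingEnd ℂ) α) = ((t - α.re) ^ 2 + α.im ^ 2 : ℝ) := by
      apply Complex.ext <;> simp only [Complex.mul_re, Complex.mul_im, Complex.sub_re,
        Complex.sub_im, Complex.conj_re, Complex.conj_im, Complex.ofReal_re, Complex.ofReal_im] <;>
        ring
    simp only [hGdef, f, h1, ← Complex.ofReal_mul, Complex.sinc_ofReal, ← Complex.ofReal_pow]
  have hG : HasExpTypeDecay (4 * δ) G := by
    have h0 : HasExpTypeDecay 4 fun w => ((w / δ - α) * (w / δ - (starRingEnd ℂ) α)) *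
        Complex.sinc w ^ 4 := by
      refine hasExpTypeDecay_mul_sinc_pow_four (by fun_prop) (D := 2 * (1 / δ ^ 2 + R ^ 2))
        fun z => ?_
      have h1 : ‖z / δ - α‖ ≤ ‖z‖ / δ + R := (norm_sub_le _ _).trans (by
        rw [norm_div, Complex.norm_real, Real.norm_of_nonneg hδ.le]; gcongr)
      have h2 : ‖z / δ - (starRingEnd ℂ) α‖ ≤ ‖z‖ / δ + R := (norm_sub_le _ _).trans (by
        rw [norm_div, Complex.norm_real, Real.norm_of_nonneg hδ.le, RCLike.norm_conj]; gcongr)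
      rw [norm_mul]
      calc _ ≤ (‖z‖ / δ + R) * (‖z‖ / δ + R) := by gcongr
        _ ≤ 2 * (‖z‖ ^ 2 * (1 / δ ^ 2) + R ^ 2) := by
          rw [show ‖z‖ ^ 2 * (1 / δ ^ 2) = (‖z‖ / δ) ^ 2 by ring]
          nlinarith [sq_nonneg (‖z‖ / δ - R)]
        _ ≤ _ := by
          have : 0 ≤ 1 / δ ^ 2 := by positivity
          nlinarith [mul_nonneg (sq_nonneg R) (sq_nonneg ‖z‖)]
    have h1 := (h0.comp_affine hδ 0).const_mul (16 * R ^ 2 : ℝ)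
    have hδ' : (δ : ℂ) ≠ 0 := by exact_mod_cast hδ.ne'
    simpa [hGdef, hδ'] using h1
  have hα2 : 1 ≤ R ^ 2 * α.im ^ 2 := by nlinarith
  have hf0 : ∀ t, 0 ≤ f t := fun t => by positivity
  have hint : Integrable f := by
    refine hG.integrable.re.congr (.of_forall fun t => ?_)
    simp [hf]
  refine ⟨G, hG.isAdmissibleMajorant (by positivity) (by nlinarith [Real.pi_gt_three]) hf
    (fun t => ?_) (by simp [hGdef]), ?_⟩
  · by_cases ht : t ∈ I
    · rw [Set.indicator_of_mem ht]
      have h1 := half_le_sinc (x := δ * t) (by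
        rw [abs_mul, abs_of_pos hδ]
        refine le_trans ?_ hδR
        gcongr
        exact abs_le.2 (hIR ht))
      have h2 := pow_le_pow_left₀ (by norm_num) h1 4
      have h3 : α.im ^ 2 ≤ (t - α.re) ^ 2 + α.im ^ 2 := by nlinarith [sq_nonneg (t - α.re)]
      calc (1 : ℝ) ≤ R ^ 2 * α.im ^ 2 := hα2
        _ = 16 * R ^ 2 * (α.im ^ 2 * (1 / 2) ^ 4) := by ring
        _ ≤ f t := by simp only [f]; gcongr
    · rw [Set.indicator_of_notMem ht]
      exact hf0 t
  · rw [excess_eq hI hab hf hint]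
    have hk := integrable_one_add_sq_mul_sinc_pow_four.comp_mul_left' hδ.ne'
    have h1 : ∫ t, f t ≤ ∫ t, 32 * R ^ 4 * (δ ^ 2)⁻¹ *
        ((1 + (δ * t) ^ 2) * Real.sinc (δ * t) ^ 4) := by
      refine integral_mono hint (hk.const_mul _) fun t => ?_
      have h2 : (t - α.re) ^ 2 + α.im ^ 2 ≤ 2 * R ^ 2 * (δ ^ 2)⁻¹ * (1 + (δ * t) ^ 2) := by
        have e1 : α.re ^ 2 + α.im ^ 2 ≤ R ^ 2 := by
          have := pow_le_pow_left₀ (norm_nonneg _) hα 2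
          rw [← Complex.normSq_eq_norm_sq, Complex.normSq_apply] at this
          nlinarith
        have e2 : 2 * R ^ 2 * (δ ^ 2)⁻¹ * (1 + (δ * t) ^ 2) =
            2 * (R ^ 2 * (δ ^ 2)⁻¹) + 2 * R ^ 2 * t ^ 2 := by field_simp
        have e3 : R ^ 2 ≤ R ^ 2 * (δ ^ 2)⁻¹ :=
          le_mul_of_one_le_right (by positivity)
            ((one_le_inv₀ (by positivity)).2 (pow_le_one₀ hδ.le hδ1))
        have e4 : t ^ 2 ≤ R ^ 2 * t ^ 2 :=
          le_mul_of_one_le_left (sq_nonneg t) (one_le_pow₀ hR)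
        nlinarith [sq_nonneg (t + α.re), sq_nonneg α.im]
      calc f t ≤ 16 * R ^ 2 * ((2 * R ^ 2 * (δ ^ 2)⁻¹ * (1 + (δ * t) ^ 2)) *
            Real.sinc (δ * t) ^ 4) := by
            simp only [f]
            have : 0 ≤ Real.sinc (δ * t) ^ 4 := by positivity
            gcongr
        _ = _ := by ring
    rw [integral_const_mul (32 * R ^ 4 * (δ ^ 2)⁻¹),
      Measure.integral_comp_mul_left (fun t => (1 + t ^ 2) * Real.sinc t ^ 4) δ,
      abs_of_pos (inv_pos.2 hδ), smul_eq_mul] at h1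
    calc (∫ t, f t) - (b - a) ≤ ∫ t, f t := by linarith
      _ ≤ _ := h1
      _ = _ := by ring

/-! ### Band-limited majorants of an interval. -/

lemma Real.mul_sinc (x : ℝ) : x * Real.sinc x = Real.sin x := by
  rcases eq_or_ne x 0 with rfl | hx
  · simp
  · rw [Real.sinc_of_ne_zero hx]; field_simp

/-- The shift by π/2 turns sin into cos, so the zeros of one square are filled by the other and sin²
+ cos² = 1 gives quadratic decay from below. -/
lemma one_le_mul_sinc_sq_add (x : ℝ) :
    1 ≤ (2 + |x|) ^ 2 * (Real.sinc x ^ 2 + Real.sinc (x + Real.pi / 2) ^ 2) := by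
  have h1 := congrArg (· ^ 2) (Real.mul_sinc x)
  have h2 := congrArg (· ^ 2) (Real.mul_sinc (x + Real.pi / 2))
  simp only [mul_pow, Real.sin_add_pi_div_two] at h1 h2
  have h3 : x ^ 2 ≤ (2 + |x|) ^ 2 := sq_le_sq' (by linarith [neg_abs_le x]) (by linarith [le_abs_self x])
  have h4 : (x + Real.pi / 2) ^ 2 ≤ (2 + |x|) ^ 2 := by
    have := Real.pi_le_four
    have := Real.pi_pos
    exact sq_le_sq' (by linarith [neg_abs_le x]) (by linarith [le_abs_self x])
  rw [← Real.sin_sq_add_cos_sq x, ← h1, ← h2, mul_add]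
  gcongr

/-- The tails of `∫ sinc ^ 4` are dominated by a band-limited function. -/
lemma setIntegral_sinc_pow_four_le {S : Set ℝ} (hS : MeasurableSet S) {x : ℝ}
    (h : ∀ t ∈ S, |x| ≤ |t|) : ∫ t in S, Real.sinc t ^ 4 ≤
      8 * (∫ t, (1 + t ^ 2) * Real.sinc t ^ 4) *
        (Real.sinc x ^ 2 + Real.sinc (x + Real.pi / 2) ^ 2) := by
  set e := Real.sinc x ^ 2 + Real.sinc (x + Real.pi / 2) ^ 2
  have he : 0 ≤ e := by positivity
  have h0 : ∀ t, 0 ≤ Real.sinc t ^ 4 := fun t => by positivity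
  calc ∫ t in S, Real.sinc t ^ 4 ≤ ∫ t in S, 8 * e * ((1 + t ^ 2) * Real.sinc t ^ 4) := by
        refine setIntegral_mono_on integrable_sinc_pow_four.integrableOn
          (integrable_one_add_sq_mul_sinc_pow_four.const_mul _).integrableOn hS fun t ht => ?_
        rw [← mul_assoc]
        refine le_mul_of_one_le_left (h0 t) ((one_le_mul_sinc_sq_add x).trans ?_)
        have h1 : (2 + |x|) ^ 2 ≤ 8 * (1 + t ^ 2) := by
          have := h t ht
          calc (2 + |x|) ^ 2 ≤ (2 + |t|) ^ 2 := by gcongr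
            _ ≤ _ := by rw [← sq_abs t]; nlinarith [sq_nonneg (|t| - 1), sq_nonneg (|t|)]
        calc _ ≤ 8 * (1 + t ^ 2) * e := by gcongr
          _ = _ := by ring
    _ ≤ ∫ t, 8 * e * ((1 + t ^ 2) * Real.sinc t ^ 4) :=
        setIntegral_le_integral (integrable_one_add_sq_mul_sinc_pow_four.const_mul _)
          (.of_forall fun t => by positivity)
    _ = _ := by rw [integral_const_mul]; ring

lemma integral_sinc_pow_four_pos : 0 < ∫ t, Real.sinc t ^ 4 := by
  refine (integral_pos_iff_support_of_nonneg (fun t => by positivity) integrable_sinc_pow_four).2 ?_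
  exact ((Real.continuous_sinc.pow 4).isOpen_support).measure_pos _ ⟨0, by simp⟩

lemma integral_one_add_sq_mul_sinc_pow_four_nonneg :
    0 ≤ ∫ t, (1 + t ^ 2) * Real.sinc t ^ 4 := integral_nonneg fun t => by positivity

section SmoothedInterval
variable {a b l : ℝ}

/-- After rescaling, the integral over [a, b] misses from the total mass of sinc⁴ only the two tails
beyond l(t − a) and l(t − b), each dominated by a band-limited bump at an endpoint. -/
lemma le_mul_intervalIntegral_sinc {t : ℝ} (hl : 0 < l) (ht : t ∈ Set.Icc a b) :
    (∫ t, Real.sinc t ^ 4) ≤ l * (∫ u in a..b, Real.sinc (l * (t - u)) ^ 4) +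
      8 * (∫ t, (1 + t ^ 2) * Real.sinc t ^ 4) *
        (Real.sinc (l * (t - a)) ^ 2 + Real.sinc (l * (t - a) + Real.pi / 2) ^ 2) +
      8 * (∫ t, (1 + t ^ 2) * Real.sinc t ^ 4) *
        (Real.sinc (l * (t - b)) ^ 2 + Real.sinc (l * (t - b) + Real.pi / 2) ^ 2) := by
  have h1 : l * (∫ u in a..b, Real.sinc (l * (t - u)) ^ 4) =
      ∫ v in (l * (t - b))..(l * (t - a)), Real.sinc v ^ 4 := by
    have := intervalIntegral.integral_comp_sub_mul (a := a) (b := b)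
      (fun v => Real.sinc v ^ 4) hl.ne' (l * t)
    simp_rw [← mul_sub] at this
    rw [this, smul_eq_mul, mul_inv_cancel_left₀ hl.ne']
  have ha : 0 ≤ l * (t - a) := mul_nonneg hl.le (sub_nonneg.2 ht.1)
  have hb : l * (t - b) ≤ 0 := mul_nonpos_of_nonneg_of_nonpos hl.le (sub_nonpos.2 ht.2)
  have hi := integrable_sinc_pow_four
  have h2 := intervalIntegral.integral_Iic_add_Ioi (b := l * (t - b)) hi.integrableOn
    hi.integrableOn
  have h3 := intervalIntegral.integral_interval_add_Ioi (a := l * (t - b)) (b := l * (t - a))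
    hi.integrableOn hi.integrableOn
  have h4 := setIntegral_sinc_pow_four_le (S := Set.Ioi (l * (t - a))) measurableSet_Ioi
    (x := l * (t - a)) fun s hs => by
      rw [abs_of_nonneg ha, abs_of_nonneg (ha.trans (le_of_lt hs))]; exact le_of_lt hs
  have h5 := setIntegral_sinc_pow_four_le (S := Set.Iic (l * (t - b))) measurableSet_Iic
    (x := l * (t - b)) fun s hs => by
      rw [abs_of_nonpos hb, abs_of_nonpos (le_trans hs hb)]; exact neg_le_neg hs
  linarith

lemma integrable_sinc_mul_sub_pow_four (hl : 0 < l) :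
    Integrable fun t : ℝ => Real.sinc (l * t) ^ 4 :=
  integrable_sinc_pow_four.comp_mul_left' hl.ne'

/-- Reduces integrability and total mass of the smoothed interval to the corresponding facts on
convolutions. -/
lemma intervalIntegral_eq_convolution (hab : a ≤ b) (f : ℝ → ℝ) (t : ℝ) :
    ∫ u in a..b, f (t - u) =
      convolution ((Set.Ioc a b).indicator fun _ => (1 : ℝ)) f (ContinuousLinearMap.mul ℝ ℝ)
        volume t := by
  rw [convolution_def, intervalIntegral.integral_of_le hab, ← integral_indicator measurableSet_Ioc]
  congr 1 with u
  by_cases hu : u ∈ Set.Ioc a b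
  · simp [Set.indicator_of_mem hu]
  · simp [Set.indicator_of_notMem hu]

lemma integrable_indicator_Ioc : Integrable ((Set.Ioc a b).indicator fun _ => (1 : ℝ)) :=
  (integrable_indicator_iff measurableSet_Ioc).2 (by simp)

lemma integrable_intervalIntegral_comp_sub (hab : a ≤ b) {f : ℝ → ℝ} (hf : Integrable f) :
    Integrable fun t => ∫ u in a..b, f (t - u) := by
  simp_rw [intervalIntegral_eq_convolution hab]
  exact integrable_indicator_Ioc.integrable_convolution _ hf

lemma integral_intervalIntegral_comp_sub (hab : a ≤ b) {f : ℝ → ℝ} (hf : Integrable f) :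
    ∫ t, ∫ u in a..b, f (t - u) = (b - a) * ∫ t, f t := by
  simp_rw [intervalIntegral_eq_convolution hab]
  rw [integral_convolution _ integrable_indicator_Ioc hf, integral_indicator measurableSet_Ioc]
  simp [hab, sub_mul]

lemma integrable_sinc_sq_affine (hl : 0 < l) (c : ℝ) :
    Integrable fun t : ℝ => Real.sinc (l * t + c) ^ 2 :=
  (integrable_sinc_sq.comp_add_right c).comp_mul_left' hl.ne'

lemma integral_sinc_sq_affine (hl : 0 < l) (c : ℝ) :
    ∫ t : ℝ, Real.sinc (l * t + c) ^ 2 = l⁻¹ * ∫ t, Real.sinc t ^ 2 := by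
  rw [Measure.integral_comp_mul_left (fun t => Real.sinc (t + c) ^ 2) l,
    integral_add_right_eq_self (fun t => Real.sinc t ^ 2), abs_of_pos (inv_pos.2 hl), smul_eq_mul]

end SmoothedInterval

/-- Band-limited majorants of intervals with excess of the order of the inverse bandwidth. -/
lemma exists_bandlimited_majorant : ∃ D : ℝ, 0 < D ∧ ∀ a b l : ℝ, a ≤ b → 0 < l →
    ∃ (M : ℂ → ℂ) (f : ℝ → ℝ), HasExpTypeDecay (4 * l) M ∧ (∀ t : ℝ, M t = f t) ∧
      (∀ t, (Set.Icc a b).indicator (fun _ => (1 : ℝ)) t ≤ f t) ∧ Integrable f ∧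
      ∫ t, f t ≤ (b - a) + D * l⁻¹ ∧
      ∀ z : ℂ, ‖M z‖ ≤ D * (l * (b - a) + 1) * Real.exp (4 * l * |z.im|) := by
  set κ := ∫ t, Real.sinc t ^ 4 with hκ
  set κ' := ∫ t, (1 + t ^ 2) * Real.sinc t ^ 4 with hκ'
  set κ₂ := ∫ t, Real.sinc t ^ 2 with hκ₂
  have hκ0 : 0 < κ := integral_sinc_pow_four_pos
  have hκ'0 : 0 ≤ κ' := integral_one_add_sq_mul_sinc_pow_four_nonneg
  have hκ₂0 : 0 ≤ κ₂ := integral_nonneg fun t => by positivity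
  set C := 8 * κ' / κ with hC
  have hC0 : 0 ≤ C := by positivity
  -- 1/κ + 4C bounds M in the complex plane; 4Cκ₂ is the scaled mass of the four endpoint bumps,
  -- each of integral κ₂/l.
  refine ⟨1 / κ + 4 * C + 4 * C * κ₂, by positivity, fun a b l hab hl => ?_⟩
  set M : ℂ → ℂ := fun z => (l / κ : ℝ) * (∫ u in a..b, Complex.sinc (l * (z - u)) ^ 4) +
    (C : ℝ) * ((Complex.sinc (l * z + (-(l * a) : ℝ)) ^ 2 +
      Complex.sinc (l * z + (-(l * a) + Real.pi / 2 : ℝ)) ^ 2) +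
    (Complex.sinc (l * z + (-(l * b) : ℝ)) ^ 2 +
      Complex.sinc (l * z + (-(l * b) + Real.pi / 2 : ℝ)) ^ 2)) with hM
  set f : ℝ → ℝ := fun t => (l / κ) * (∫ u in a..b, Real.sinc (l * (t - u)) ^ 4) +
    C * ((Real.sinc (l * t + -(l * a)) ^ 2 + Real.sinc (l * t + (-(l * a) + Real.pi / 2)) ^ 2) +
      (Real.sinc (l * t + -(l * b)) ^ 2 + Real.sinc (l * t + (-(l * b) + Real.pi / 2)) ^ 2))
    with hf
  have hiK := integrable_sinc_mul_sub_pow_four hl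
  have hi1 := integrable_intervalIntegral_comp_sub hab hiK
  have hi2 := fun c => integrable_sinc_sq_affine hl c
  have hi4 : ∀ c d : ℝ, Integrable fun t : ℝ =>
      Real.sinc (l * t + c) ^ 2 + Real.sinc (l * t + d) ^ 2 := fun c d => (hi2 c).add (hi2 d)
  have hi3 : Integrable fun t : ℝ =>
      (Real.sinc (l * t + -(l * a)) ^ 2 + Real.sinc (l * t + (-(l * a) + Real.pi / 2)) ^ 2) +
      (Real.sinc (l * t + -(l * b)) ^ 2 + Real.sinc (l * t + (-(l * b) + Real.pi / 2)) ^ 2) :=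
    (hi4 _ _).add (hi4 _ _)
  have hS : ∀ c : ℝ, HasExpTypeDecay (4 * l) fun z => Complex.sinc (l * z + c) ^ 2 := fun c =>
    (hasExpTypeDecay_sinc_sq.comp_affine hl c).mono (by linarith)
  have hK : HasExpTypeDecay (4 * l) fun z => Complex.sinc (l * z) ^ 4 := by
    simpa using hasExpTypeDecay_sinc_pow_four.comp_affine hl 0
  refine ⟨M, f, ?_, fun t => ?_, fun t => ?_, ?_, ?_, fun z => ?_⟩
  · exact ((hK.intervalIntegral_comp_sub a b).const_mul _).add
      ((((hS _).add (hS _)).add ((hS _).add (hS _))).const_mul _)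
  · simp only [hM, hf, ← Complex.ofReal_sub, ← Complex.ofReal_mul, ← Complex.ofReal_add,
      Complex.sinc_ofReal, ← Complex.ofReal_pow, intervalIntegral.integral_ofReal]
  · by_cases ht : t ∈ Set.Icc a b
    · rw [Set.indicator_of_mem ht]
      have h1 := le_mul_intervalIntegral_sinc hl ht
      rw [← hκ, ← hκ'] at h1
      rw [← div_le_div_iff_of_pos_right hκ0, div_self hκ0.ne'] at h1
      refine h1.trans (le_of_eq ?_)
      simp only [hf, hC]
      ring_nf
    · rw [Set.indicator_of_notMem ht]
      have : 0 ≤ ∫ u in a..b, Real.sinc (l * (t - u)) ^ 4 :=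
        intervalIntegral.integral_nonneg hab fun u _ => by positivity
      positivity
  · exact (hi1.const_mul _).add (hi3.const_mul _)
  · have h1 : ∫ t, f t = (l / κ) * ((b - a) * (l⁻¹ * κ)) + C * ((l⁻¹ * κ₂ + l⁻¹ * κ₂) +
        (l⁻¹ * κ₂ + l⁻¹ * κ₂)) := by
      simp only [hf]
      rw [integral_add (hi1.const_mul _) (hi3.const_mul _), integral_const_mul,
        integral_const_mul, integral_intervalIntegral_comp_sub hab hiK,
        Measure.integral_comp_mul_left (fun t => Real.sinc t ^ 4) l, abs_of_pos (inv_pos.2 hl),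
        smul_eq_mul]
      congr 2
      rw [integral_add (hi4 _ _) (hi4 _ _),
        integral_add (hi2 _) (hi2 _), integral_add (hi2 _) (hi2 _)]
      simp only [integral_sinc_sq_affine hl, ← hκ₂]
    have h2 : (l / κ) * ((b - a) * (l⁻¹ * κ)) = b - a := by field_simp
    rw [h1, h2]
    have h3 : 0 ≤ (1 / κ + 4 * C) * l⁻¹ := by positivity
    nlinarith
  · set E := Real.exp (4 * l * |z.im|) with hE
    have hE2 : ∀ c : ℝ, ‖Complex.sinc (l * z + c) ^ 2‖ ≤ E := fun c => by
      rw [norm_pow]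
      refine (pow_le_pow_left₀ (norm_nonneg _) (Complex.norm_sinc_le _) 2).trans ?_
      rw [← Real.exp_nat_mul, hE]
      simp only [Complex.add_im, Complex.im_ofReal_mul, Complex.ofReal_im, add_zero, abs_mul,
        abs_of_pos hl]
      refine Real.exp_le_exp.2 ?_
      push_cast
      nlinarith [mul_nonneg hl.le (abs_nonneg z.im)]
    have hE4 : ‖∫ u in a..b, Complex.sinc (l * (z - u)) ^ 4‖ ≤ E * (b - a) := by
      rw [← abs_of_nonneg (sub_nonneg.2 hab)]
      refine intervalIntegral.norm_integral_le_of_norm_le_const fun u _ => ?_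
      rw [norm_pow]
      refine (pow_le_pow_left₀ (norm_nonneg _) (Complex.norm_sinc_le _) 4).trans ?_
      rw [← Real.exp_nat_mul, hE]
      simp only [Complex.sub_im, Complex.im_ofReal_mul, Complex.ofReal_im, sub_zero, abs_mul,
        abs_of_pos hl]
      refine Real.exp_le_exp.2 (le_of_eq ?_)
      push_cast
      ring
    have hE0 : 0 < E := Real.exp_pos _
    have hlk : 0 ≤ l / κ := by positivity
    calc ‖M z‖ ≤ l / κ * (E * (b - a)) + C * ((E + E) + (E + E)) := by
          refine (norm_add_le _ _).trans (add_le_add ?_ ?_)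
          · rw [norm_mul, Complex.norm_real, Real.norm_of_nonneg hlk]; gcongr
          · rw [norm_mul, Complex.norm_real, Real.norm_of_nonneg hC0]
            gcongr
            exact (norm_add_le _ _).trans (add_le_add
              ((norm_add_le _ _).trans (add_le_add (hE2 _) (hE2 _)))
              ((norm_add_le _ _).trans (add_le_add (hE2 _) (hE2 _))))
      _ ≤ _ := by
          have h5 : 0 ≤ l * (b - a) := mul_nonneg hl.le (sub_nonneg.2 hab)
          have h6 : 0 ≤ 1 / κ := by positivity
          have h7 : 0 ≤ C * κ₂ := by positivity
          have h8 : l / κ * (b - a) + 4 * C ≤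
              (1 / κ + 4 * C + 4 * C * κ₂) * (l * (b - a) + 1) := by
            have e : l / κ * (b - a) = 1 / κ * (l * (b - a)) := by ring
            rw [e]
            nlinarith [mul_nonneg hC0 h5, mul_nonneg h7 h5]
          calc _ = (l / κ * (b - a) + 4 * C) * E := by ring
            _ ≤ _ := by gcongr

/-! ### Upper bound for large bandwidth: forcing the zero at α. -/

lemma exp_le_four_mul_sinh {x : ℝ} (hx : 1 ≤ x) : Real.exp x ≤ 4 * Real.sinh x := by
  rw [Real.sinh_eq]
  have h1 : Real.exp (-x) ≤ 1 := Real.exp_le_one_iff.2 (by linarith)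
  have h2 : 2 ≤ Real.exp x := by linarith [Real.add_one_le_exp x]
  linarith

/-- Band-limited functions, nonnegative on the line, with a prescribed value at a complex point. -/
lemma exists_nonneg_bandlimited_eq {α v : ℂ} {R δ : ℝ} (hR : 1 ≤ R) (hα : ‖α‖ ≤ R)
    (hα' : 1 ≤ R * α.im) (hδ : R ≤ δ) :
    ∃ (c : ℂ → ℂ) (f : ℝ → ℝ), HasExpTypeDecay (4 * δ) c ∧ (∀ t : ℝ, c t = f t) ∧
      (∀ t, 0 ≤ f t) ∧ Integrable f ∧ c α = v ∧
      ∫ t, f t ≤ 2048 * (∫ t, (1 + t ^ 2) * Real.sinc t ^ 4) * R ^ 8 * δ ^ 4 *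
        Real.exp (-(4 * (δ * α.im))) * ‖v‖ * δ⁻¹ := by
  have hR0 : 0 < R := one_pos.trans_le hR
  have hδ0 : 0 < δ := hR0.trans_le hδ
  have hδ1 : 1 ≤ δ := hR.trans hδ
  have hy : 0 < α.im := by by_contra h; nlinarith
  have hδy : 1 ≤ δ * α.im := hα'.trans (by gcongr)
  have hδ' : (δ : ℂ) ≠ 0 := by exact_mod_cast hδ0.ne'
  -- A square root of v lets the interpolating function be a square with real coefficients, hence
  -- nonnegative on the line.
  obtain ⟨w, hw⟩ : ∃ w : ℂ, w ^ 2 = v := IsAlgClosed.exists_pow_nat_eq v two_pos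
  set S := Complex.sinc (δ * α) ^ 2 with hS
  have hSlow : Real.exp (2 * (δ * α.im)) ≤ 16 * (δ * R) ^ 2 * ‖S‖ := by
    have h1 := Complex.sinh_abs_im_le_norm_sin (δ * α)
    rw [← Complex.mul_sinc, norm_mul, norm_mul, Complex.norm_real, Real.norm_of_nonneg hδ0.le,
      Complex.im_ofReal_mul, abs_of_pos (by positivity)] at h1
    have h2 : Real.exp (δ * α.im) ≤ 4 * (δ * R * ‖Complex.sinc (δ * α)‖) := by
      refine (exp_le_four_mul_sinh hδy).trans ?_
      gcongr
      exact h1.trans (by gcongr)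
    have h3 := pow_le_pow_left₀ (Real.exp_pos _).le h2 2
    rw [← Real.exp_nat_mul] at h3
    rw [hS, norm_pow]
    push_cast at h3
    linarith
  have hSpos : 0 < ‖S‖ := by
    by_contra h
    have h1 : ‖S‖ = 0 := le_antisymm (not_lt.1 h) (norm_nonneg _)
    rw [h1, mul_zero] at hSlow
    exact absurd hSlow (not_le.2 (Real.exp_pos _))
  have hS0 : S ≠ 0 := norm_pos_iff.1 hSpos
  -- Since Im α ≠ 0, the numbers 1 and α span ℂ over ℝ; p and r are the real coordinates of w/S.
  set r := (w / S).im / α.im with hr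
  set p := (w / S).re - r * α.re with hp
  set q := ‖w / S‖ with hq
  have hpr : (p : ℂ) + r * α = w / S := by
    apply Complex.ext
    · simp [hp]
    · simp [hr, hy.ne']
  have hq2 : q ^ 2 ≤ 256 * R ^ 4 * δ ^ 4 * Real.exp (-(4 * (δ * α.im))) * ‖v‖ := by
    have h1 := pow_le_pow_left₀ (Real.exp_pos _).le hSlow 2
    rw [← Real.exp_nat_mul] at h1
    rw [hq, norm_div, div_pow, ← norm_pow, hw, div_le_iff₀ (by positivity), Real.exp_neg]
    have h2 : 0 < Real.exp (4 * (δ * α.im)) := Real.exp_pos _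
    rw [show ((2 : ℕ) : ℝ) * (2 * (δ * α.im)) = 4 * (δ * α.im) by push_cast; ring] at h1
    calc ‖v‖ = Real.exp (4 * (δ * α.im)) * ((Real.exp (4 * (δ * α.im)))⁻¹ * ‖v‖) := by
          field_simp
      _ ≤ (16 * (δ * R) ^ 2 * ‖S‖) ^ 2 * ((Real.exp (4 * (δ * α.im)))⁻¹ * ‖v‖) := by gcongr
      _ = _ := by ring
  have hr_le : |r| ≤ R * q := by
    rw [hr, abs_div, abs_of_pos hy, div_le_iff₀ hy]
    calc |(w / S).im| ≤ q := Complex.abs_im_le_norm _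
      _ ≤ (R * α.im) * q := le_mul_of_one_le_left (norm_nonneg _) hα'
      _ = _ := by ring
  have hq0 : 0 ≤ q := norm_nonneg _
  have hp_le : |p| ≤ 2 * R ^ 2 * q := by
    calc |p| ≤ |(w / S).re| + |r * α.re| := abs_sub _ _
      _ ≤ q + R * q * R := by
        rw [abs_mul]
        gcongr
        · exact Complex.abs_re_le_norm _
        · exact (Complex.abs_re_le_norm _).trans hα
      _ ≤ _ := by nlinarith [mul_nonneg hq0 (sub_nonneg.2 (one_le_pow₀ hR (n := 2)))]
  have hp2 : p ^ 2 ≤ 4 * R ^ 4 * q ^ 2 := by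
    rw [← sq_abs]
    exact (pow_le_pow_left₀ (abs_nonneg _) hp_le 2).trans (le_of_eq (by ring))
  have hr2 : r ^ 2 ≤ 4 * R ^ 4 * q ^ 2 := by
    rw [← sq_abs]
    refine (pow_le_pow_left₀ (abs_nonneg _) hr_le 2).trans ?_
    rw [mul_pow]
    have : R ^ 2 ≤ R ^ 4 := pow_le_pow_right₀ hR (by norm_num)
    nlinarith [sq_nonneg q, mul_nonneg (sq_nonneg q) (sub_nonneg.2 this),
      mul_nonneg (sq_nonneg q) (sq_nonneg R)]
  set c : ℂ → ℂ := fun z => (p + r * z) ^ 2 * Complex.sinc (δ * z) ^ 4 with hc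
  set f : ℝ → ℝ := fun t => (p + r * t) ^ 2 * Real.sinc (δ * t) ^ 4 with hf
  have hcf : ∀ t : ℝ, c t = f t := fun t => by
    simp only [hc, hf, ← Complex.ofReal_mul, Complex.sinc_ofReal, ← Complex.ofReal_add,
      ← Complex.ofReal_pow]
  have hcd : HasExpTypeDecay (4 * δ) c := by
    have h0 : HasExpTypeDecay 4 fun z => (p + r * (z / δ)) ^ 2 * Complex.sinc z ^ 4 := by
      refine hasExpTypeDecay_mul_sinc_pow_four (by fun_prop) (D := 2 * (p ^ 2 + (r / δ) ^ 2))
        fun z => ?_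
      rw [norm_pow]
      have h1 : ‖(p : ℂ) + r * (z / δ)‖ ≤ |p| + |r / δ| * ‖z‖ := by
        refine (norm_add_le _ _).trans (le_of_eq ?_)
        rw [norm_mul, norm_div, Complex.norm_real, Complex.norm_real, Complex.norm_real, abs_div]
        simp only [Real.norm_eq_abs]
        ring
      calc _ ≤ (|p| + |r / δ| * ‖z‖) ^ 2 := by gcongr
        _ ≤ 2 * (|p| ^ 2 + (|r / δ| * ‖z‖) ^ 2) := add_sq_le
        _ ≤ _ := by
          rw [mul_pow, sq_abs, sq_abs]
          nlinarith [mul_nonneg (sq_nonneg p) (sq_nonneg ‖z‖), sq_nonneg (r / δ)]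
    have h1 := h0.comp_affine hδ0 0
    simpa [hc, hδ'] using h1
  have hfi : Integrable f := by
    refine hcd.integrable.re.congr (.of_forall fun t => ?_)
    simp [hcf]
  refine ⟨c, f, hcd, hcf, fun t => by positivity, hfi, ?_, ?_⟩
  · simp only [hc, hpr]
    rw [show Complex.sinc (δ * α) ^ 4 = S ^ 2 by rw [hS]; ring, ← mul_pow, div_mul_cancel₀ _ hS0, hw]
  · have hk := integrable_one_add_sq_mul_sinc_pow_four.comp_mul_left' hδ0.ne'
    have h1 : ∫ t, f t ≤ ∫ t, 8 * R ^ 4 * q ^ 2 * ((1 + (δ * t) ^ 2) * Real.sinc (δ * t) ^ 4) := by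
      refine integral_mono hfi (hk.const_mul _) fun t => ?_
      have h2 : (p + r * t) ^ 2 ≤ 8 * R ^ 4 * q ^ 2 * (1 + (δ * t) ^ 2) := by
        have e1 : t ^ 2 ≤ (δ * t) ^ 2 := by
          rw [mul_pow]; exact le_mul_of_one_le_left (sq_nonneg t) (one_le_pow₀ hδ1)
        calc _ ≤ 2 * (p ^ 2 + (r * t) ^ 2) := add_sq_le
          _ = 2 * (p ^ 2 + r ^ 2 * t ^ 2) := by ring
          _ ≤ 2 * (4 * R ^ 4 * q ^ 2 + 4 * R ^ 4 * q ^ 2 * (δ * t) ^ 2) := by gcongr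
          _ = _ := by ring
      simp only [hf]
      rw [← mul_assoc]
      gcongr
    rw [integral_const_mul (8 * R ^ 4 * q ^ 2),
      Measure.integral_comp_mul_left (fun t => (1 + t ^ 2) * Real.sinc t ^ 4) δ,
      abs_of_pos (inv_pos.2 hδ0), smul_eq_mul] at h1
    have hk0 := integral_one_add_sq_mul_sinc_pow_four_nonneg
    set κ := ∫ t, (1 + t ^ 2) * Real.sinc t ^ 4
    calc ∫ t, f t ≤ _ := h1
      _ ≤ 8 * R ^ 4 * (256 * R ^ 4 * δ ^ 4 * Real.exp (-(4 * (δ * α.im))) * ‖v‖) * (δ⁻¹ * κ) := by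
        gcongr
      _ = _ := by ring

/-- For large bandwidth, a majorant of the interval is corrected to vanish at `α` at the cost of
an excess of the order of the inverse bandwidth. -/
lemma exists_admissible_of_large_bandwidth : ∃ D : ℝ, 0 < D ∧ ∀ (α : ℂ) (I : Set ℝ) (a b δ R : ℝ),
    1 ≤ R → R ≤ δ → ‖α‖ ≤ R → 1 ≤ R * α.im → I =ᵐ[volume] Set.Icc a b → a ≤ b →
    I ⊆ Set.Icc a b → -R ≤ a → b ≤ R →
    ∃ G, IsAdmissibleMajorant α I δ G ∧
      ∫ t : ℝ, ((G t).re - I.indicator (fun _ => (1 : ℝ)) t) ≤ D * R ^ 14 * δ⁻¹ := by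
  obtain ⟨D, hD0, hD⟩ := exists_bandlimited_majorant
  have hκ0 := integral_one_add_sq_mul_sinc_pow_four_nonneg
  set κ := ∫ t, (1 + t ^ 2) * Real.sinc t ^ 4 with hκ
  refine ⟨2 * D + 16384 * κ * D, by positivity,
    fun α I a b δ R hR hδ hα hα' hI hab hIab ha hb => ?_⟩
  have hR0 : 0 < R := one_pos.trans_le hR
  have hδ0 : 0 < δ := hR0.trans_le hδ
  have hδ1 : 1 ≤ δ := hR.trans hδ
  have hy : 0 < α.im := by by_contra h; nlinarith
  -- The parameter δ/2 keeps M of type 2δ, below the type 4δ of the correction, so a factor exp(−2δ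
  -- Im α) survives.
  obtain ⟨M, f, hM, hMf, hfI, hfi, hfint, hMb⟩ := hD a b (δ / 2) hab (by positivity)
  obtain ⟨c, g, hc, hcg, hg0, hgi, hcα, hgint⟩ :=
    exists_nonneg_bandlimited_eq (v := -M α) hR hα hα' hδ
  rw [← hκ, norm_neg] at hgint
  have hMα : ‖M α‖ ≤ 2 * D * δ * R * Real.exp (2 * (δ * α.im)) := by
    refine (hMb α).trans ?_
    rw [abs_of_pos hy, show 4 * (δ / 2) * α.im = 2 * (δ * α.im) by ring]
    have h1 : δ / 2 * (b - a) + 1 ≤ 2 * δ * R := by nlinarith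
    calc _ ≤ D * (2 * δ * R) * Real.exp (2 * (δ * α.im)) := by gcongr
      _ = _ := by ring
  -- The fifth power collects δ⁴ from the correction and δ from the bound for M(α); it is beaten by
  -- x⁵/5! ≤ exp x at x = 2δ Im α.
  have hexp : δ ^ 5 * Real.exp (-(2 * (δ * α.im))) ≤ 4 * R ^ 5 := by
    rw [Real.exp_neg, ← div_eq_mul_inv, div_le_iff₀ (Real.exp_pos _)]
    have h1 := Real.pow_div_factorial_le_exp (2 * (δ * α.im)) (by positivity) 5
    have h2 : (1 : ℝ) ≤ (R * α.im) ^ 5 := one_le_pow₀ hα'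
    calc δ ^ 5 ≤ (16 / 15) * (δ ^ 5 * (R * α.im) ^ 5) := by
          nlinarith [le_mul_of_one_le_right (pow_nonneg hδ0.le 5) h2, pow_pos hδ0 5]
      _ = 4 * R ^ 5 * ((2 * (δ * α.im)) ^ 5 / (Nat.factorial 5 : ℕ)) := by
          norm_num [Nat.factorial]; ring
      _ ≤ _ := by gcongr
  have hG : HasExpTypeDecay (4 * δ) fun z => M z + c z := (hM.mono (by linarith)).add hc
  have hGf : ∀ t : ℝ, M t + c t = ((f t + g t : ℝ) : ℂ) := fun t => by simp [hMf, hcg]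
  refine ⟨fun z => M z + c z, hG.isAdmissibleMajorant (by positivity)
    (by nlinarith [Real.pi_gt_three]) hGf (fun t => ?_) (by simp [hcα]), ?_⟩
  · exact (Set.indicator_le_indicator_of_subset hIab (fun _ => zero_le_one) t).trans
      ((hfI t).trans (le_add_of_nonneg_right (hg0 t)))
  · rw [excess_eq (G := fun z => M z + c z) (f := fun t => f t + g t) hI hab hGf (hfi.add hgi),
      integral_add hfi hgi]
    have h1 : ∫ t, g t ≤ 16384 * κ * D * R ^ 14 * δ⁻¹ := by
      calc ∫ t, g t ≤ _ := hgint
        _ ≤ 2048 * κ * R ^ 8 * δ ^ 4 * Real.exp (-(4 * (δ * α.im))) *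
            (2 * D * δ * R * Real.exp (2 * (δ * α.im))) * δ⁻¹ := by gcongr
        _ = 4096 * κ * D * R ^ 9 * (δ ^ 5 * (Real.exp (-(4 * (δ * α.im))) *
            Real.exp (2 * (δ * α.im)))) * δ⁻¹ := by ring
        _ = 4096 * κ * D * R ^ 9 * (δ ^ 5 * Real.exp (-(2 * (δ * α.im)))) * δ⁻¹ := by
            rw [← Real.exp_add]; ring_nf
        _ ≤ 4096 * κ * D * R ^ 9 * (4 * R ^ 5) * δ⁻¹ := by gcongr
        _ = _ := by ring
    have h2 : D * (δ / 2)⁻¹ ≤ 2 * D * R ^ 14 * δ⁻¹ := by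
      calc D * (δ / 2)⁻¹ = 2 * D * 1 * δ⁻¹ := by rw [inv_div]; ring
        _ ≤ _ := by
          gcongr
          exact one_le_pow₀ hR
    linarith

/-! ### Computable constants, the infimum, and the final bounds. -/

lemma computable_const_mul_succ_pow (B k : ℕ) : Computable fun N : ℕ => B * (N + 1) ^ k := by
  refine (Primrec.nat_mul.comp (.const B) ?_).to_comp
  induction k with
  | zero => simpa using Primrec.const 1
  | succ k ih => simpa only [pow_succ] using Primrec.nat_mul.comp ih Primrec.succ

/-- An admissible function must be exhibited, since `sInf ∅ = 0` would defeat a positive lower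
bound. -/
lemma le_rho {α : ℂ} {I : Set ℝ} {δ r : ℝ} (hne : ∃ G, IsAdmissibleMajorant α I δ G)
    (h : ∀ G, IsAdmissibleMajorant α I δ G →
      r ≤ ∫ t : ℝ, ((G t).re - I.indicator (fun _ => (1 : ℝ)) t)) : r ≤ rho α I δ := by
  obtain ⟨G, hG⟩ := hne
  refine le_csInf ⟨_, G, hG, rfl⟩ ?_
  rintro _ ⟨F, hF, rfl⟩
  exact h F hF

lemma IsAdmissibleMajorant.rho_le {α : ℂ} {I : Set ℝ} {δ : ℝ} {G : ℂ → ℂ}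
    (h : IsAdmissibleMajorant α I δ G) :
    rho α I δ ≤ ∫ t : ℝ, ((G t).re - I.indicator (fun _ => (1 : ℝ)) t) := by
  refine csInf_le ⟨0, ?_⟩ ⟨G, h, rfl⟩
  rintro _ ⟨F, hF, rfl⟩
  exact hF.excess_nonneg

theorem theorem1 :
    ∃ A : ℕ → ℕ, Computable A ∧ (∀ N : ℕ, 0 < A N) ∧
      ∀ (N : ℕ) (α : ℂ) (I : Set ℝ), ‖α‖ ≤ (N : ℝ) → 1 ≤ (N : ℝ) * α.im →
        I.OrdConnected → I.Nonempty → I ⊆ Set.Icc (-(N : ℝ)) (N : ℝ) →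
        (∀ δ : ℝ, 0 < δ → δ ≤ (A N : ℝ)⁻¹ →
          (A N : ℝ)⁻¹ * (δ ^ 2)⁻¹ ≤ rho α I δ ∧ rho α I δ ≤ (A N : ℝ) * (δ ^ 3)⁻¹) ∧
        (∀ δ : ℝ, (A N : ℝ) ≤ δ →
          (A N : ℝ)⁻¹ * δ⁻¹ ≤ rho α I δ ∧ rho α I δ ≤ (A N : ℝ) * δ⁻¹) := by
  obtain ⟨D, hD0, hD⟩ := exists_admissible_of_large_bandwidth
  have hκ0 := integral_one_add_sq_mul_sinc_pow_four_nonneg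
  set κ := ∫ t, (1 + t ^ 2) * Real.sinc t ^ 4 with hκ
  -- 640 serves the lower bounds, 32κ and D the upper ones. B is one fixed natural number, so
  -- computability of A needs no value for κ or D.
  obtain ⟨B, hB⟩ := exists_nat_ge (640 + 32 * κ + D)
  have hB640 : (640 : ℝ) ≤ B := by linarith
  have hB0 : 0 < B := by exact_mod_cast (show (0 : ℝ) < B by linarith)
  refine ⟨fun N => B * (N + 1) ^ 14, computable_const_mul_succ_pow B 14,
    fun N => by positivity, fun N α I hα hα' hI hne hIN => ?_⟩
  have hN : 1 ≤ (N : ℝ) := by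
    rcases Nat.eq_zero_or_pos N with rfl | h
    · simp at hα'; linarith
    · exact_mod_cast h
  have hbb : BddBelow I := ⟨_, fun x hx => (hIN hx).1⟩
  have hba : BddAbove I := ⟨_, fun x hx => (hIN hx).2⟩
  have hae := hI.ae_eq_Icc hne hbb hba
  have hIab : I ⊆ Set.Icc (sInf I) (sSup I) := fun x hx => ⟨csInf_le hbb hx, le_csSup hba hx⟩
  have hab : sInf I ≤ sSup I := csInf_le_csSup hne hbb hba
  have ha : -(N : ℝ) ≤ sInf I := le_csInf hne fun x hx => (hIN hx).1
  have hb : sSup I ≤ N := csSup_le hne fun x hx => (hIN hx).2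
  have hA' : (B : ℝ) * (N : ℝ) ^ 14 ≤ ((B * (N + 1) ^ 14 : ℕ) : ℝ) := by
    push_cast
    gcongr
    linarith
  generalize ((B * (N + 1) ^ 14 : ℕ) : ℝ) = A at *
  generalize (N : ℝ) = R at *
  have hR0 : 0 < R := one_pos.trans_le hN
  have hAR : 640 * R ≤ A := by
    refine le_trans ?_ hA'
    gcongr
    exact le_self_pow₀ hN (by norm_num)
  have hA0 : 0 < A := by linarith
  refine ⟨fun δ hδ hδA => ?_, fun δ hδA => ?_⟩
  · have hδR : 640 * R * δ ≤ 1 := by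
      calc 640 * R * δ ≤ A * A⁻¹ := by gcongr
        _ = 1 := mul_inv_cancel₀ hA0.ne'
    obtain ⟨G, hG, hGle⟩ := exists_admissible_of_small_bandwidth hδ hN (by nlinarith) hα hα' hae
      hab hIN
    refine ⟨le_rho ⟨G, hG⟩ fun F hF => ?_, hG.rho_le.trans (hGle.trans ?_)⟩
    · refine le_trans ?_ (hF.excess_ge_of_small_bandwidth hδ hN (by nlinarith) hα hae hab hne ha
        hb hIN)
      have h1 : A⁻¹ * (δ ^ 2)⁻¹ ≤ (640 * R)⁻¹ * (δ ^ 2)⁻¹ := by gcongr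
      -- The subtracted 2R is at most a quarter of the main term (160R)⁻¹δ⁻², because 640Rδ ≤ 1.
      have h2 : 2 * R ≤ (640 * R)⁻¹ * (δ ^ 2)⁻¹ := by
        rw [← mul_inv, ← one_div, le_div_iff₀ (by positivity)]
        have h3 : (640 * R * δ) ^ 2 ≤ 1 := pow_le_one₀ (by positivity) hδR
        nlinarith [sq_nonneg (R * δ)]
      have h4 : (160 * R)⁻¹ * (δ ^ 2)⁻¹ = 4 * ((640 * R)⁻¹ * (δ ^ 2)⁻¹) := by
        rw [mul_inv, mul_inv 640]; ring
      have h5 : 0 ≤ (640 * R)⁻¹ * (δ ^ 2)⁻¹ := by positivity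
      linarith
    · gcongr
      refine le_trans ?_ hA'
      calc 32 * R ^ 4 * κ = (32 * κ) * R ^ 4 := by ring
        _ ≤ B * R ^ 14 := by
          gcongr
          · linarith
          · norm_num
  · have hδ : 0 < δ := hA0.trans_le hδA
    obtain ⟨G, hG, hGle⟩ := hD α I _ _ δ R hN (by linarith) hα hα' hae hab hIab ha hb
    refine ⟨le_rho ⟨G, hG⟩ fun F hF =>
      le_trans ?_ (hF.excess_ge_of_large_bandwidth hδ hae hab hne), hG.rho_le.trans (hGle.trans ?_)⟩
    · gcongr
      linarith
    · gcongr
      refine le_trans ?_ hA'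
      gcongr
      linarith
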